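/- Let $m,d,e,k$ be positive integers with $e=\gcd(m,d)=\gcd(m,2d)$ and $2\le k\le \frac{m+e}{2e}$. Let $s$ be a maximum-length binary sequence of length $2^m-1$, i.e. a nonzero sequence $(s_t)_{t\in\mathbb Z/(2^m-1)}$ over $\mathbb F_2$ that satisfies a linear recurrence of order $m$ over $\mathbb F_2$ and has least period $2^m-1$. For $1\le j\le k-1$ let $s_j=(s_{f_jt})_{t}$ be the circular decimation of $s$ with factor $f_j$, where either $f_j=2^{jd}+1$ for all $j$, or $f_j=2^{(2j-1)d}+1$ for all $j$, or $f_j=2^{(\frac{m+e}{2e}-j)d}+1$ for all $j$. Let $C$ be the $\mathbb F_2$-vector space generated by all circular shifts of $s,s_1,\dots,s_{k-1}$. For $c=(c_0,\dots,c_{2^m-2})\in C$ put $\mathrm{DC}(c)=\sum_{t=0}^{2^m-2}(-1)^{c_t}$, and for $\varepsilon=\pm1$ and even $r$ with $0\le r\le\frac{m-e}{e}$ put \[\alpha_{r,\varepsilon}=\#\{0\ne c\in C\mid \mathrm{DC}(c)=-1+\varepsilon 2^{m-\frac{er}{2}}\}.\] Then for each $i=0,1,\dots,k-2$ and each $\varepsilon=\pm1$,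 \[\alpha_{\frac{m-e}{e}-2i,\varepsilon}=\frac12\left(2^{m-e-2ei}+\varepsilon 2^{\frac{m-e}{2}-ei}\right)\sum_{j=i}^{k-2}(-1)^{j-i}4^{e\binom{j-i}{2}}\binom{j}{i}_{4^e}\binom{\frac{m-e}{2e}}{j}_{4^e}\left(2^{m(k-1-j)}-1\right),\] where $\binom{a}{b}_q=\prod_{h=0}^{b-1}\frac{q^a-q^h}{q^b-q^h}$ is the Gaussian binomial coefficient. (Here $\alpha_{\frac{m-e}{e}-2i,\varepsilon}$ counts the nonzero codewords with DC component $-1+\varepsilon2^{\frac{m+e}{2}+ei}$.) -/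

import Mathlib

namespace GoldType

/-- Binary sequences of length `n`, indexed cyclically. -/
abbrev BinSeq (n : ℕ) : Type := ZMod n → ZMod 2

/-- The circular shift of a sequence by `u` places. -/
def shift {n : ℕ} (u : ZMod n) (s : BinSeq n) : BinSeq n := fun t => s (t + u)

/-- The circular decimation of a sequence with decimation factor `f`. -/
def decimate {n : ℕ} (f : ℕ) (s : BinSeq n) : BinSeq n := fun t => s ((f : ZMod n) * t)

/-- A maximum-length binary sequence of length `2 ^ m - 1`: a nonzero sequence produced by a linear
feedback shift register with `m` cells whose least period is `2 ^ m - 1`. -/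
def IsMaximumLength (m : ℕ) (s : BinSeq (2 ^ m - 1)) : Prop :=
  s ≠ 0 ∧
  (∃ a : Fin m → ZMod 2, ∀ t : ZMod (2 ^ m - 1),
    s (t + (m : ZMod (2 ^ m - 1))) = ∑ l : Fin m, a l * s (t + ((l : ℕ) : ZMod (2 ^ m - 1)))) ∧
  ∀ u : ZMod (2 ^ m - 1), shift u s = s → u = 0

/-- The three families of decimation factors. -/
inductive Family : Type
  | consecutive
  | odd
  | descending

/-- The multiple of `d` in the exponent of the `j`-th decimation factor (`1 ≤ j ≤ k - 1`). -/
def Family.multiplier (m e : ℕ) : Family → ℕ → ℕ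
  | .consecutive, j => j
  | .odd, j => 2 * j - 1
  | .descending, j => (m + e) / (2 * e) - j

/-- The `j`-th decimation factor. -/
def Family.factor (F : Family) (m d e j : ℕ) : ℕ := 2 ^ (F.multiplier m e j * d) + 1

/-- The Gold type code: the `𝔽₂`-span of all circular shifts of `s, s₁, …, s_{k-1}`, where `s_j` is
the decimation of `s` by the `j`-th factor of the family. -/
def code (F : Family) (m d e k : ℕ) (s : BinSeq (2 ^ m - 1)) :
    Submodule (ZMod 2) (BinSeq (2 ^ m - 1)) :=
  Submodule.span (ZMod 2)
    {c | ∃ u : ZMod (2 ^ m - 1), c = shift u s ∨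
      ∃ j ∈ Finset.Icc 1 (k - 1), c = shift u (decimate (F.factor m d e j) s)}

/-- The DC component of a binary sequence of length `n`. -/
def DC {n : ℕ} (c : BinSeq n) : ℤ :=
  ∑ t ∈ Finset.range n, (-1 : ℤ) ^ (c (t : ZMod n)).val

/-- The number of nonzero codewords of `C` with DC component `-1 + ε 2 ^ (m - e r / 2)`, for even
`r`. -/
noncomputable def dcFrequency (m e : ℕ) (C : Submodule (ZMod 2) (BinSeq (2 ^ m - 1)))
    (r : ℕ) (ε : ℤ) : ℕ :=
  Set.ncard {c : BinSeq (2 ^ m - 1) | c ∈ C ∧ c ≠ 0 ∧ DC c = -1 + ε * 2 ^ (m - e * r / 2)}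

/-- The Gaussian binomial coefficient (`q ≠ 0` not a root of unity). -/
def gaussBinom (q : ℚ) (a b : ℕ) : ℚ :=
  ∏ h ∈ Finset.range b, (q ^ a - q ^ h) / (q ^ b - q ^ h)

end GoldType

/-!
Writing `s_t = Tr(b γ ^ t)`, the codewords are the sequences `Tr(∑_j a_j x ρ_j(x) + b x)` with
`x = γ ^ t`, where the `ρ_j` are Galois automorphisms, so the DC component is `-1` plus an
exponential sum whose square is governed by the radical of the polar form of
`Tr(∑_j a_j x ρ_j(x))`. It remains to count the `a` with a radical of given dimension.

These polar forms constitute an optimal set of alternating forms in the sense of Delsarte and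
Goethals. An operator supported on a short arc of the cyclic Galois group behaves like a polynomial
of low degree and has a small kernel; in each family the automorphisms `ρ_j` and their inverses
fill an arc, and the remaining nontrivial automorphisms fill the complementary one. By duality, few
independent vectors are annihilated by as many polar forms as for a random choice. This determines
the moments of the distribution of radicals, which are inverted by a Gaussian binomial inversion to
the base `q ^ 2`, where `q` is the order of the fixed field of the Galois group.
-/

namespace GoldType

open Finset Module Polynomial

/-! ### Gaussian binomial coefficients -/

section GaussBinom

variable {q : ℚ}

lemma pow_sub_pow_ne_zero (hq : 1 < q) {a b : ℕ} (h : a ≠ b) : q ^ a - q ^ b ≠ 0 :=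
  sub_ne_zero.2 fun H => h (pow_right_injective₀ (zero_lt_one.trans hq) hq.ne' H)

lemma pow_succ_sub_one_ne_zero (hq : 1 < q) (a : ℕ) : q ^ (a + 1) - 1 ≠ 0 := by
  simpa using pow_sub_pow_ne_zero hq a.succ_ne_zero

@[simp]
lemma gaussBinom_zero_right (a : ℕ) : gaussBinom q a 0 = 1 := by
  simp [gaussBinom]

lemma gaussBinom_eq_zero_of_lt {a b : ℕ} (h : a < b) : gaussBinom q a b = 0 :=
  prod_eq_zero (mem_range.2 h) (by simp)

lemma gaussBinom_eq_div (a b : ℕ) :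
    gaussBinom q a b = (∏ h ∈ range b, (q ^ a - q ^ h)) / ∏ h ∈ range b, (q ^ b - q ^ h) :=
  prod_div_distrib _ _

lemma prod_pow_self_sub_pow_ne_zero (hq : 1 < q) (b : ℕ) :
    ∏ h ∈ range b, (q ^ b - q ^ h) ≠ 0 :=
  prod_ne_zero_iff.2 fun _ hh => pow_sub_pow_ne_zero hq (mem_range.1 hh).ne'

lemma gaussBinom_self (hq : 1 < q) (a : ℕ) : gaussBinom q a a = 1 := by
  rw [gaussBinom_eq_div, div_self (prod_pow_self_sub_pow_ne_zero hq a)]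

lemma gaussBinom_succ_succ_mul (hq : 1 < q) (a b : ℕ) :
    gaussBinom q (a + 1) (b + 1) * (q ^ (b + 1) - 1) = (q ^ (a + 1) - 1) * gaussBinom q a b := by
  have hq0 : q ≠ 0 := (zero_lt_one.trans hq).ne'
  have cancel_q : ∀ h : ℕ, (q ^ (a + 1) - q ^ (h + 1)) / (q ^ (b + 1) - q ^ (h + 1)) =
      (q ^ a - q ^ h) / (q ^ b - q ^ h) := fun h => by
    rw [pow_succ, pow_succ, pow_succ, ← sub_mul, ← sub_mul, mul_div_mul_right _ _ hq0]
  rw [gaussBinom, gaussBinom, prod_range_succ', prod_congr rfl fun h _ => cancel_q h, pow_zero,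
    mul_assoc, div_mul_cancel₀ _ (pow_succ_sub_one_ne_zero hq b), mul_comm]

lemma gaussBinom_succ_right_mul (hq : 1 < q) (a b : ℕ) :
    gaussBinom q a (b + 1) * (q ^ b * (q ^ (b + 1) - 1)) =
      gaussBinom q a b * (q ^ a - q ^ b) := by
  have : q ≠ 0 := (zero_lt_one.trans hq).ne'
  have denom_succ : ∏ h ∈ range (b + 1), (q ^ (b + 1) - q ^ h) =
      (∏ h ∈ range b, (q ^ b - q ^ h)) * (q ^ b * (q ^ (b + 1) - 1)) := by
    have factor_q : ∀ h : ℕ, q ^ (b + 1) - q ^ (h + 1) = (q ^ b - q ^ h) * q := fun h => by ring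
    rw [prod_range_succ', ← mul_assoc, prod_congr rfl fun h _ => factor_q h, prod_mul_distrib]
    simp
  have := prod_pow_self_sub_pow_ne_zero hq b
  have := pow_succ_sub_one_ne_zero hq b
  rw [gaussBinom_eq_div, gaussBinom_eq_div, denom_succ, prod_range_succ]
  field_simp

lemma gaussBinom_pascal (hq : 1 < q) (a b : ℕ) :
    gaussBinom q (a + 1) (b + 1) = gaussBinom q a b + q ^ (b + 1) * gaussBinom q a (b + 1) := by
  apply mul_right_cancel₀ (pow_succ_sub_one_ne_zero hq b)
  rw [gaussBinom_succ_succ_mul hq, add_mul]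
  linear_combination (-q) * gaussBinom_succ_right_mul hq a b

lemma gaussBinom_mul_gaussBinom (hq : 1 < q) (i y l : ℕ) :
    gaussBinom q (i + y) (i + l) * gaussBinom q (i + l) i =
      gaussBinom q (i + y) i * gaussBinom q y l := by
  induction i with
  | zero => simp
  | succ i ih =>
    rw [show i + 1 + y = i + y + 1 by ring, show i + 1 + l = i + l + 1 by ring]
    apply mul_right_cancel₀
      (mul_ne_zero (pow_succ_sub_one_ne_zero hq (i + l)) (pow_succ_sub_one_ne_zero hq i))
    calc _ = (gaussBinom q (i + y + 1) (i + l + 1) * (q ^ (i + l + 1) - 1)) *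
          (gaussBinom q (i + l + 1) (i + 1) * (q ^ (i + 1) - 1)) := by ring
      _ = (gaussBinom q (i + y) (i + l) * gaussBinom q (i + l) i) *
          ((q ^ (i + y + 1) - 1) * (q ^ (i + l + 1) - 1)) := by
        rw [gaussBinom_succ_succ_mul hq, gaussBinom_succ_succ_mul hq]; ring
      _ = (gaussBinom q (i + y + 1) (i + 1) * (q ^ (i + 1) - 1)) *
          gaussBinom q y l * (q ^ (i + l + 1) - 1) := by
        rw [ih, gaussBinom_succ_succ_mul hq]; ring
      _ = _ := by ring

lemma sum_neg_one_pow_mul_gaussBinom_succ (hq : 1 < q) (y t : ℕ) :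
    ∑ l ∈ range (t + 1), (-1) ^ l * q ^ l.choose 2 * gaussBinom q (y + 1) l =
      (-1) ^ t * q ^ (t + 1).choose 2 * gaussBinom q y t := by
  induction t with
  | zero => simp
  | succ t ih =>
    rw [sum_range_succ, ih, gaussBinom_pascal hq,
      show (t + 1 + 1).choose 2 = (t + 1) + (t + 1).choose 2 by
        rw [Nat.choose_succ_succ' (t + 1) 1, Nat.choose_one_right]]
    ring

lemma sum_neg_one_pow_mul_gaussBinom (hq : 1 < q) {y t : ℕ} (h : y ≤ t) :
    ∑ l ∈ range (t + 1), (-1) ^ l * q ^ l.choose 2 * gaussBinom q y l =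
      if y = 0 then 1 else 0 := by
  rcases y with _ | y
  · rw [sum_range_succ', sum_eq_zero fun l _ => by
      rw [gaussBinom_eq_zero_of_lt l.succ_pos, mul_zero]]
    simp
  · rw [sum_neg_one_pow_mul_gaussBinom_succ hq, gaussBinom_eq_zero_of_lt (by omega)]
    simp

lemma sum_gaussBinom_mul_gaussBinom (hq : 1 < q) {i x M : ℕ} (hi : i ≤ M) (hx : x ≤ M) :
    ∑ j ∈ Icc i M,
      (-1) ^ (j - i) * q ^ (j - i).choose 2 * gaussBinom q j i * gaussBinom q x j =
        if x = i then 1 else 0 := by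
  rcases lt_or_ge x i with h | h
  · rw [if_neg h.ne, sum_eq_zero]
    intro j hj
    rw [gaussBinom_eq_zero_of_lt (h.trans_le (mem_Icc.1 hj).1), mul_zero]
  · obtain ⟨y, rfl⟩ := Nat.exists_eq_add_of_le h
    obtain ⟨t, rfl⟩ := Nat.exists_eq_add_of_le hi
    have summand_eq : ∀ l ∈ range (t + 1),
        (-1) ^ (i + l - i) * q ^ (i + l - i).choose 2 * gaussBinom q (i + l) i *
          gaussBinom q (i + y) (i + l) =
        gaussBinom q (i + y) i * ((-1) ^ l * q ^ l.choose 2 * gaussBinom q y l) := by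
      intro l _
      rw [Nat.add_sub_cancel_left]
      linear_combination (-1) ^ l * q ^ l.choose 2 * gaussBinom_mul_gaussBinom hq i y l
    rw [← Ico_add_one_right_eq_Icc, sum_Ico_eq_sum_range, show i + t + 1 - i = t + 1 by omega,
      sum_congr rfl summand_eq, ← mul_sum, sum_neg_one_pow_mul_gaussBinom hq (by omega)]
    rcases y with _ | y
    · simp [gaussBinom_self hq]
    · simp

theorem gaussBinom_inversion (hq : 1 < q) {M : ℕ} {A c : ℕ → ℚ}
    (h : ∀ j ≤ M, ∑ x ∈ range (M + 1), A x * gaussBinom q x j = c j) {i : ℕ} (hi : i ≤ M) :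
    A i = ∑ j ∈ Icc i M, (-1) ^ (j - i) * q ^ (j - i).choose 2 * gaussBinom q j i * c j := by
  symm
  calc ∑ j ∈ Icc i M, (-1) ^ (j - i) * q ^ (j - i).choose 2 * gaussBinom q j i * c j
      = ∑ j ∈ Icc i M, ∑ x ∈ range (M + 1), A x *
          ((-1) ^ (j - i) * q ^ (j - i).choose 2 * gaussBinom q j i * gaussBinom q x j) := by
        refine sum_congr rfl fun j hj => ?_
        rw [← h j (mem_Icc.1 hj).2, mul_sum]
        exact sum_congr rfl fun x _ => by ring
    _ = ∑ x ∈ range (M + 1), A x * if x = i then 1 else 0 := by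
        rw [sum_comm]
        refine sum_congr rfl fun x hx => ?_
        rw [← mul_sum, sum_gaussBinom_mul_gaussBinom hq hi (Nat.lt_succ_iff.1 (mem_range.1 hx))]
    _ = A i := by simp [hi]

end GaussBinom

/-! ### Products of `Z - q ^ l` and products of `Z - q ^ (2 * l + 1)` -/

section OddCoeff

/-- The coefficients of `∏_{l < u} (Z - q ^ l)` in the basis `∏_{l < j} (Z - q ^ (2 * l + 1))`.
They convert the moments of the size of the radical of an alternating form, whose rank is even,
into moments given by Gaussian binomial coefficients with base `q ^ 2`. -/
def oddCoeff {R : Type*} [CommRing R] (q : R) : ℕ → ℕ → R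
  | 0, 0 => 1
  | 0, _ + 1 => 0
  | u + 1, 0 => (q - q ^ u) * oddCoeff q u 0
  | u + 1, j + 1 => oddCoeff q u j + (q ^ (2 * (j + 1) + 1) - q ^ u) * oddCoeff q u (j + 1)

variable {R : Type*} [CommRing R] {q : R}

lemma oddCoeff_eq_zero {u j : ℕ} (h : u < j) : oddCoeff q u j = 0 := by
  induction u generalizing j with
  | zero =>
    obtain ⟨j, rfl⟩ := Nat.exists_eq_succ_of_ne_zero h.ne'
    rfl
  | succ u ih =>
    obtain ⟨j, rfl⟩ := Nat.exists_eq_succ_of_ne_zero (by omega : j ≠ 0)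
    rw [Nat.succ_eq_add_one, oddCoeff, ih (by omega), ih (by omega), mul_zero, add_zero]

lemma oddCoeff_self (u : ℕ) : oddCoeff q u u = 1 := by
  induction u with
  | zero => rfl
  | succ u ih => rw [oddCoeff, ih, oddCoeff_eq_zero (by omega), mul_zero, add_zero]

lemma sum_oddCoeff_succ (u : ℕ) (F : ℕ → R) :
    ∑ j ∈ range (u + 2), oddCoeff q (u + 1) j * F j =
      ∑ j ∈ range (u + 1), oddCoeff q u j * (F (j + 1) + (q ^ (2 * j + 1) - q ^ u) * F j) := by
  have extend_range : ∑ j ∈ range (u + 1), oddCoeff q u j * ((q ^ (2 * j + 1) - q ^ u) * F j) =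
      ∑ j ∈ range (u + 2), oddCoeff q u j * ((q ^ (2 * j + 1) - q ^ u) * F j) := by
    rw [sum_range_succ _ (u + 1), oddCoeff_eq_zero u.lt_succ_self, zero_mul, add_zero]
  simp_rw [mul_add]
  rw [sum_add_distrib, extend_range, sum_range_succ', sum_range_succ' _ (u + 1), ← add_assoc,
    ← sum_add_distrib]
  congr 1
  · exact sum_congr rfl fun j _ => by rw [oddCoeff]; ring
  · rw [oddCoeff]; ring

lemma prod_sub_pow_eq_sum_oddCoeff (Z : R) (u : ℕ) :
    ∏ l ∈ range u, (Z - q ^ l) =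
      ∑ j ∈ range (u + 1), oddCoeff q u j * ∏ l ∈ range j, (Z - q ^ (2 * l + 1)) := by
  induction u with
  | zero => simp [oddCoeff]
  | succ u ih =>
    rw [sum_oddCoeff_succ, prod_range_succ, ih, sum_mul]
    refine sum_congr rfl fun j _ => ?_
    rw [prod_range_succ]
    ring

lemma one_sub_mul_prod_one_sub_odd_pow (w : R) (j : ℕ) :
    (1 - q * w) * ∏ l ∈ range j, (1 - q ^ (2 * l + 1) * (q ^ 2 * w)) =
      (∏ l ∈ range j, (1 - q ^ (2 * l + 1) * w)) * (1 - q ^ (2 * j + 1) * w) := by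
  rw [← prod_range_succ (fun l => 1 - q ^ (2 * l + 1) * w), prod_range_succ', mul_comm]
  congr 1
  · exact prod_congr rfl fun l _ => by ring
  · ring

lemma one_sub_mul_prod_one_sub_pow (w : R) (u : ℕ) :
    (1 - w) * (1 - q * w) * ∏ l ∈ range u, (q ^ (l + 1) * (1 - q ^ l * (q ^ 2 * w))) =
      (∏ l ∈ range u, (q ^ (l + 1) * (1 - q ^ l * w))) *
        ((1 - q ^ u * w) * (1 - q ^ (u + 1) * w)) := by
  have telescope : (∏ l ∈ range u, (1 - q ^ l * w)) * (1 - q ^ u * w) * (1 - q ^ (u + 1) * w) =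
      (∏ l ∈ range u, (1 - q ^ l * (q ^ 2 * w))) * (1 - q * w) * (1 - w) := by
    rw [← prod_range_succ (fun l => 1 - q ^ l * w), ← prod_range_succ (fun l => 1 - q ^ l * w),
      prod_range_succ', prod_range_succ', prod_congr rfl fun l _ =>
        show 1 - q ^ (l + 1 + 1) * w = 1 - q ^ l * (q ^ 2 * w) by ring]
    ring
  rw [prod_mul_distrib, prod_mul_distrib]
  linear_combination -(∏ l ∈ range u, q ^ (l + 1)) * telescope

variable [IsDomain R]

lemma sum_oddCoeff_mul_prod (u : ℕ) {w : R} (hq : q ≠ 0) (hw : w ≠ 0) :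
    ∑ j ∈ range (u + 1), oddCoeff q u j * ∏ l ∈ range j, (1 - q ^ (2 * l + 1) * w) =
      ∏ l ∈ range u, (q ^ (l + 1) * (1 - q ^ l * w)) := by
  induction u generalizing w with
  | zero => simp [oddCoeff]
  | succ u ih =>
    have shifted := one_sub_mul_prod_one_sub_pow (q := q) w u
    rw [← ih (mul_ne_zero (pow_ne_zero 2 hq) hw)] at shifted
    rw [sum_oddCoeff_succ, prod_range_succ]
    apply mul_left_cancel₀ hw
    have summand_eq : ∀ j ∈ range (u + 1),
        w * (oddCoeff q u j * (∏ l ∈ range (j + 1), (1 - q ^ (2 * l + 1) * w) +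
          (q ^ (2 * j + 1) - q ^ u) * ∏ l ∈ range j, (1 - q ^ (2 * l + 1) * w))) =
        (1 - q ^ u * w) * (oddCoeff q u j * ∏ l ∈ range j, (1 - q ^ (2 * l + 1) * w)) -
        (1 - w) * (1 - q * w) *
          (oddCoeff q u j * ∏ l ∈ range j, (1 - q ^ (2 * l + 1) * (q ^ 2 * w))) := by
      intro j _
      rw [prod_range_succ]
      linear_combination oddCoeff q u j * (1 - w) * one_sub_mul_prod_one_sub_odd_pow (q := q) w j
    rw [mul_sum, sum_congr rfl summand_eq, sum_sub_distrib, ← mul_sum, ← mul_sum, shifted, ih hw]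
    ring

lemma sum_prod_sub_odd_pow {α : Type*} (s : Finset α) (Z : α → R) {N w : R} {κ : ℕ} (hq : q ≠ 0)
    (hw : w ≠ 0)
    (h : ∀ r ≤ κ, ∑ a ∈ s, ∏ l ∈ range r, (Z a - q ^ l) =
      N * ∏ l ∈ range r, (q ^ (l + 1) * (1 - q ^ l * w))) {j : ℕ} (hj : j ≤ κ) :
    ∑ a ∈ s, ∏ l ∈ range j, (Z a - q ^ (2 * l + 1)) =
      N * ∏ l ∈ range j, (1 - q ^ (2 * l + 1) * w) := by
  induction j using Nat.strong_induction_on with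
  | _ j ih =>
    have moment := h j hj
    simp_rw [prod_sub_pow_eq_sum_oddCoeff] at moment
    rw [← sum_oddCoeff_mul_prod j hq hw, sum_comm] at moment
    simp_rw [← mul_sum] at moment
    rw [sum_range_succ, sum_range_succ, oddCoeff_self, one_mul, one_mul, mul_add, mul_sum,
      sum_congr rfl fun i hi => by rw [ih i (mem_range.1 hi) ((mem_range.1 hi).le.trans hj)],
      sum_congr rfl fun i _ => mul_left_comm _ N _] at moment
    exact add_left_cancel moment

end OddCoeff

lemma prod_odd_pow_sub_odd_pow {R : Type*} [CommRing R] (q : R) (x j : ℕ) :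
    ∏ l ∈ range j, (q ^ (2 * x + 1) - q ^ (2 * l + 1)) =
      q ^ j * ∏ l ∈ range j, ((q ^ 2) ^ x - (q ^ 2) ^ l) := by
  rw [pow_eq_prod_const q j, ← prod_mul_distrib]
  exact prod_congr rfl fun l _ => by rw [← pow_mul, ← pow_mul]; ring

lemma pow_mul_prod_one_sub_mul_inv {F : Type*} [Field F] {w : F} (hw : w ≠ 0) (f : ℕ → F) {j κ : ℕ}
    (hj : j ≤ κ) :
    w ^ κ * ∏ l ∈ range j, (1 - f l * w⁻¹) = w ^ (κ - j) * ∏ l ∈ range j, (w - f l) := by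
  have factor : ∀ l ∈ range j, w - f l = w * (1 - f l * w⁻¹) := fun l _ => by field_simp
  rw [prod_congr rfl factor, prod_mul_distrib, prod_const, card_range, ← mul_assoc, ← pow_add,
    Nat.sub_add_cancel hj]

theorem sum_gaussBinom_sq {q : ℚ} {α : Type*} (s : Finset α) (x : α → ℕ) {h κ : ℕ} (hq : 1 < q)
    (moments : ∀ r ≤ κ, ∑ a ∈ s, ∏ l ∈ range r, (q ^ (2 * x a + 1) - q ^ l) =
      q ^ ((2 * h + 1) * κ) * ∏ l ∈ range r, (q ^ (l + 1) * (1 - q ^ l * (q ^ (2 * h + 1))⁻¹)))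
    {j : ℕ} (hj : j ≤ κ) :
    ∑ a ∈ s, gaussBinom (q ^ 2) (x a) j =
      q ^ ((2 * h + 1) * (κ - j)) * gaussBinom (q ^ 2) h j := by
  have hq0 : q ≠ 0 := (zero_lt_one.trans hq).ne'
  have hw : q ^ (2 * h + 1) ≠ 0 := pow_ne_zero _ hq0
  have odd_moment := sum_prod_sub_odd_pow s (fun a => q ^ (2 * x a + 1)) hq0 (inv_ne_zero hw)
    moments hj
  simp_rw [prod_odd_pow_sub_odd_pow] at odd_moment
  rw [pow_mul, pow_mul_prod_one_sub_mul_inv hw _ hj, prod_odd_pow_sub_odd_pow, ← pow_mul,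
    ← mul_sum, mul_left_comm] at odd_moment
  simp_rw [gaussBinom_eq_div]
  rw [← sum_div, mul_left_cancel₀ (pow_ne_zero j hq0) odd_moment, mul_div_assoc]

/-! ### Kernels of linear combinations of field automorphisms -/

section LinearAlgebra

variable {K V V' V'' : Type*} [Field K] [AddCommGroup V] [Module K V] [AddCommGroup V']
  [Module K V'] [AddCommGroup V''] [Module K V''] [FiniteDimensional K V]

lemma finrank_ker_comp_le [FiniteDimensional K V'] (f : V →ₗ[K] V') (g : V' →ₗ[K] V'') :
    finrank K (LinearMap.ker (g ∘ₗ f)) ≤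
      finrank K (LinearMap.ker f) + finrank K (LinearMap.ker g) := by
  set f' := f.domRestrict (LinearMap.ker (g ∘ₗ f))
  have range_le : finrank K (LinearMap.range f') ≤ finrank K (LinearMap.ker g) := by
    apply Submodule.finrank_mono
    rintro _ ⟨x, rfl⟩
    exact x.2
  have ker_le : finrank K (LinearMap.ker f') ≤ finrank K (LinearMap.ker f) := by
    rw [← Submodule.finrank_map_subtype_eq]
    apply Submodule.finrank_mono
    rintro _ ⟨x, hx, rfl⟩
    exact hx
  have := f'.finrank_range_add_finrank_ker
  omega

lemma finrank_ker_le_finrank_ker_comp {f : V →ₗ[K] V'} (hf : Function.Surjective f)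
    (g : V' →ₗ[K] V'') :
    finrank K (LinearMap.ker g) ≤ finrank K (LinearMap.ker (g ∘ₗ f)) := by
  rw [LinearMap.ker_comp]
  conv_lhs => rw [← Submodule.map_comap_eq_of_surjective hf (LinearMap.ker g)]
  exact Submodule.finrank_map_le _ _

end LinearAlgebra

section Automorphisms

variable {K L : Type*} [Field K] [Field L] [Algebra K L]

/-- The operator `∑_{l < D} c_l τ ^ l`, that is, the value at `τ` of a skew polynomial. -/
def skewPoly (τ : L ≃ₐ[K] L) (c : ℕ → L) (D : ℕ) : L →ₗ[K] L :=
  ∑ l ∈ range D, LinearMap.mulLeft K (c l) ∘ₗ (τ ^ l).toLinearMap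

lemma skewPoly_apply (τ : L ≃ₐ[K] L) (c : ℕ → L) (D : ℕ) (x : L) :
    skewPoly τ c D x = ∑ l ∈ range D, c l * (τ ^ l) x := by
  simp [skewPoly, LinearMap.sum_apply]

/-- A root `z` of a skew polynomial splits off the factor `1 - τ`, by summation by parts. -/
lemma skewPoly_comp_mulRight (τ : L ≃ₐ[K] L) (c : ℕ → L) (D : ℕ) {z : L}
    (hz : skewPoly τ c (D + 1) z = 0) :
    skewPoly τ c (D + 1) ∘ₗ LinearMap.mulRight K z =
      skewPoly τ (fun l => skewPoly τ c (l + 1) z) D ∘ₗ (LinearMap.id - τ.toLinearMap) := by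
  ext x
  calc skewPoly τ c (D + 1) (x * z)
      = ∑ l ∈ range (D + 1), (τ ^ l) x • (c l * (τ ^ l) z) := by
        rw [skewPoly_apply]
        exact sum_congr rfl fun l _ => by rw [map_mul, smul_eq_mul]; ring
    _ = -∑ l ∈ range D, ((τ ^ (l + 1)) x - (τ ^ l) x) • skewPoly τ c (l + 1) z := by
        rw [sum_range_by_parts]
        simp only [← skewPoly_apply, hz, Nat.add_sub_cancel, smul_zero, zero_sub]
    _ = _ := by
        rw [LinearMap.comp_apply, skewPoly_apply, ← sum_neg_distrib]
        refine sum_congr rfl fun l _ => ?_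
        rw [LinearMap.sub_apply, LinearMap.id_apply, AlgEquiv.toLinearMap_apply, map_sub, pow_succ,
          AlgEquiv.mul_apply, smul_eq_mul]
        ring

lemma eq_zero_of_forall_skewPoly_eq_zero {τ : L ≃ₐ[K] L} {c : ℕ → L} {z : L} (hz : z ≠ 0) {D : ℕ}
    (h : ∀ l ≤ D, skewPoly τ c l z = 0) {l : ℕ} (hl : l < D) : c l = 0 := by
  have summand : c l * (τ ^ l) z = 0 := by
    have := h (l + 1) hl
    rwa [skewPoly_apply, sum_range_succ, ← skewPoly_apply, h l hl.le, zero_add] at this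
  exact (mul_eq_zero.1 summand).resolve_right ((map_ne_zero_iff _ (τ ^ l).injective).2 hz)

lemma finrank_ker_id_sub_le_one {τ : L ≃ₐ[K] L}
    (hτ : ∀ x : L, τ x = x → x ∈ (algebraMap K L).range) :
    finrank K (LinearMap.ker (LinearMap.id - τ.toLinearMap)) ≤ 1 := by
  refine le_trans (Submodule.finrank_mono (t := Submodule.span K {(1 : L)}) fun x hx => ?_)
    (finrank_span_singleton one_ne_zero).le
  obtain ⟨y, rfl⟩ := hτ x (sub_eq_zero.1 (LinearMap.mem_ker.1 hx)).symm
  exact Submodule.mem_span_singleton.2 ⟨y, by rw [Algebra.smul_def, mul_one]⟩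

variable [FiniteDimensional K L]

lemma finrank_ker_skewPoly_le {τ : L ≃ₐ[K] L}
    (hτ : ∀ x : L, τ x = x → x ∈ (algebraMap K L).range) (c : ℕ → L) (D : ℕ)
    (hc : ∃ l ≤ D, c l ≠ 0) : finrank K (LinearMap.ker (skewPoly τ c (D + 1))) ≤ D := by
  induction D generalizing c with
  | zero =>
    obtain ⟨l, hl, h⟩ := hc
    obtain rfl : l = 0 := by omega
    rw [Nat.le_zero, Submodule.finrank_eq_zero, LinearMap.ker_eq_bot']
    intro x hx
    rw [skewPoly_apply] at hx
    simpa [h] using hx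
  | succ D ih =>
    by_cases hbot : LinearMap.ker (skewPoly τ c (D + 1 + 1)) = ⊥
    · rw [hbot, finrank_bot]
      omega
    obtain ⟨z, hz, hz0⟩ := Submodule.exists_mem_ne_zero_of_ne_bot hbot
    have mulRight_surjective : Function.Surjective (LinearMap.mulRight K z) := fun y =>
      ⟨y * z⁻¹, by simp [hz0]⟩
    have partial_sum_ne_zero : ∃ l ≤ D, skewPoly τ c (l + 1) z ≠ 0 := by
      by_contra! h
      obtain ⟨l, hl, hcl⟩ := hc
      refine hcl (eq_zero_of_forall_skewPoly_eq_zero (τ := τ) hz0 (fun i hi => ?_)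
        (Nat.lt_succ_of_le hl))
      rcases i with _ | i
      · simp [skewPoly_apply]
      · rcases (Nat.le_of_succ_le_succ hi).eq_or_lt with rfl | hi
        · exact hz
        · exact h i (by omega)
    calc finrank K (LinearMap.ker (skewPoly τ c (D + 1 + 1)))
        ≤ finrank K (LinearMap.ker (skewPoly τ c (D + 1 + 1) ∘ₗ LinearMap.mulRight K z)) :=
          finrank_ker_le_finrank_ker_comp mulRight_surjective _
      _ ≤ finrank K (LinearMap.ker (LinearMap.id - τ.toLinearMap)) +
            finrank K (LinearMap.ker (skewPoly τ (fun l => skewPoly τ c (l + 1) z) (D + 1))) := by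
          rw [skewPoly_comp_mulRight τ c (D + 1) hz]
          exact finrank_ker_comp_le _ _
      _ ≤ 1 + D := add_le_add (finrank_ker_id_sub_le_one hτ) (ih _ partial_sum_ne_zero)
      _ = D + 1 := add_comm 1 D

/-- The operator `x ↦ ∑_g C_g g(x)`. -/
noncomputable def galOp (C : (L ≃ₐ[K] L) → L) : L →ₗ[K] L :=
  ∑ g, LinearMap.mulLeft K (C g) ∘ₗ g.toLinearMap

lemma galOp_apply (C : (L ≃ₐ[K] L) → L) (x : L) : galOp C x = ∑ g, C g * g x := by
  simp [galOp, LinearMap.sum_apply]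

/-- Nonzero linear combinations of the automorphisms in `S` have kernels of dimension at most `D`
over `K`. -/
def HasKernelBound (S : Set (L ≃ₐ[K] L)) (D : ℕ) : Prop :=
  ∀ C : (L ≃ₐ[K] L) → L, C ≠ 0 → Function.support C ⊆ S → finrank K (LinearMap.ker (galOp C)) ≤ D

lemma HasKernelBound.mono {S T : Set (L ≃ₐ[K] L)} {D : ℕ} (hT : HasKernelBound T D) (h : S ⊆ T) :
    HasKernelBound S D := fun C hC hsupp => hT C hC (hsupp.trans h)

/-- The `D + 1` consecutive elements `β, βτ, …, βτ ^ D`. -/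
def arc {G : Type*} [Group G] (β τ : G) (D : ℕ) : Set G := {g | ∃ l ≤ D, g = β * τ ^ l}

lemma galOp_eq_comp_skewPoly {τ : L ≃ₐ[K] L} {C : (L ≃ₐ[K] L) → L} {β : L ≃ₐ[K] L} {D : ℕ}
    (hD : D < orderOf τ) (hsupp : Function.support C ⊆ arc β τ D) :
    galOp C = β.toLinearMap ∘ₗ skewPoly τ (fun l => β⁻¹ (C (β * τ ^ l))) (D + 1) := by
  classical
  have injOn : Set.InjOn (fun l => β * τ ^ l) (range (D + 1) : Set ℕ) := by
    intro i hi j hj hij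
    simp only [coe_range, Set.mem_Iio] at hi hj
    exact pow_injOn_Iio_orderOf (show i < _ by omega) (show j < _ by omega)
      (mul_left_cancel hij)
  have apply_inv_apply : ∀ y, β (β⁻¹ y) = y := β.apply_symm_apply
  ext x
  rw [LinearMap.comp_apply, galOp_apply, skewPoly_apply, AlgEquiv.toLinearMap_apply, map_sum]
  simp_rw [map_mul, apply_inv_apply]
  rw [← sum_subset (subset_univ ((range (D + 1)).image fun l => β * τ ^ l)), sum_image injOn]
  · rfl
  · intro g _ hg
    by_contra h
    obtain ⟨l, hl, rfl⟩ := hsupp (left_ne_zero_of_mul h)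
    exact hg (mem_image_of_mem _ (mem_range.2 (by omega)))

theorem hasKernelBound_arc {τ : L ≃ₐ[K] L} (hτ : ∀ x : L, τ x = x → x ∈ (algebraMap K L).range)
    (β : L ≃ₐ[K] L) {D : ℕ} (hD : D < orderOf τ) : HasKernelBound (arc β τ D) D := by
  intro C hC hsupp
  rw [galOp_eq_comp_skewPoly hD hsupp,
    LinearMap.ker_comp_of_ker_eq_bot _ (LinearMap.ker_eq_bot.2 β.injective)]
  apply finrank_ker_skewPoly_le hτ
  obtain ⟨g, hg⟩ := Function.ne_iff.1 hC
  obtain ⟨l, hl, rfl⟩ := hsupp hg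
  exact ⟨l, hl, (map_ne_zero_iff _ (β⁻¹).injective).2 hg⟩

end Automorphisms

/-! ### Polar forms -/

section Polar

variable {K L ι : Type*} [Field K] [Field L] [Algebra K L] [Fintype ι]

/-- The operator `N_a` for which `Tr(N_a(x) y) = ∑_j Tr(a_j (ρ_j(x) y - x ρ_j(y)))`; in
characteristic two this is the polarisation of the quadratic form `Tr(∑_j a_j x ρ_j(x))`. -/
def polarOp (ρ : ι → L ≃ₐ[K] L) (a : ι → L) : L →ₗ[K] L :=
  ∑ j, (LinearMap.mulLeft K (a j) ∘ₗ (ρ j).toLinearMap -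
    (ρ j)⁻¹.toLinearMap ∘ₗ LinearMap.mulLeft K (a j))

lemma polarOp_apply (ρ : ι → L ≃ₐ[K] L) (a : ι → L) (x : L) :
    polarOp ρ a x = ∑ j, (a j * ρ j x - (ρ j)⁻¹ (a j * x)) := by
  simp [polarOp, LinearMap.sum_apply]

@[simp]
lemma polarOp_zero (ρ : ι → L ≃ₐ[K] L) : polarOp ρ 0 = 0 := by
  ext x
  simp [polarOp_apply]

lemma trace_inv_apply_mul (g : L ≃ₐ[K] L) (x y : L) :
    Algebra.trace K L (g⁻¹ x * y) = Algebra.trace K L (x * g y) := by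
  rw [← Algebra.trace_eq_of_algEquiv g, map_mul]
  congr 2
  exact g.apply_symm_apply x

lemma trace_polarOp_mul (ρ : ι → L ≃ₐ[K] L) (a : ι → L) (x y : L) :
    Algebra.trace K L (polarOp ρ a x * y) =
      ∑ j, Algebra.trace K L (a j * (ρ j x * y - x * ρ j y)) := by
  simp only [polarOp_apply, sum_mul, map_sum, sub_mul, mul_sub, map_sub, trace_inv_apply_mul,
    mul_assoc]

/-- The bilinear form `∑_i Tr(v_i w_i)` on families of field elements. -/
noncomputable def piTraceForm (K L ι : Type*) [Field K] [Field L] [Algebra K L] [Fintype ι] :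
    LinearMap.BilinForm K (ι → L) :=
  ∑ i, (Algebra.traceForm K L).compl₁₂ (LinearMap.proj i) (LinearMap.proj i)

lemma piTraceForm_apply (v w : ι → L) :
    piTraceForm K L ι v w = ∑ i, Algebra.trace K L (v i * w i) := by
  simp [piTraceForm, LinearMap.sum_apply, Algebra.traceForm_apply]

/-- The automorphisms occurring in the operators `polarOp ρ a`. -/
def symmRange {G : Type*} [Group G] (ρ : ι → G) : Set G := {g | ∃ j, g = ρ j ∨ g = (ρ j)⁻¹}

/-- The systems of automorphisms whose polar forms constitute an optimal set of alternating forms: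
the operators supported on the `ρ_j` and their inverses, and those supported on the remaining
nontrivial automorphisms, have kernels as small as the respective numbers of automorphisms allow
for a cyclic Galois group of odd order. -/
structure IsGoldSystem [FiniteDimensional K L] (ρ : ι → L ≃ₐ[K] L) : Prop where
  injective : Function.Injective ρ
  ne_inv : ∀ i j, ρ i ≠ (ρ j)⁻¹
  two_mul_card_lt : 2 * Fintype.card ι < finrank K L
  thin : HasKernelBound (symmRange ρ) (2 * Fintype.card ι)
  cothin : HasKernelBound (insert 1 (symmRange ρ))ᶜ (finrank K L - 2 * Fintype.card ι - 1)

section FiniteDimensional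

variable [FiniteDimensional K L]

open Classical in
lemma polarOp_eq_galOp (ρ : ι → L ≃ₐ[K] L) (a : ι → L) :
    polarOp ρ a = galOp fun g =>
      ∑ j, ((if g = ρ j then a j else 0) - if g = (ρ j)⁻¹ then (ρ j)⁻¹ (a j) else 0) := by
  ext x
  rw [polarOp_apply, galOp_apply]
  simp only [sum_mul, sub_mul, ite_mul, zero_mul]
  rw [sum_comm]
  simp [sum_sub_distrib]

theorem IsGoldSystem.finrank_ker_polarOp_le {ρ : ι → L ≃ₐ[K] L} (hρ : IsGoldSystem ρ) {a : ι → L}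
    (ha : a ≠ 0) : finrank K (LinearMap.ker (polarOp ρ a)) ≤ 2 * Fintype.card ι := by
  classical
  rw [polarOp_eq_galOp]
  refine hρ.thin _ ?_ fun g hg => ?_
  · obtain ⟨i, hi⟩ := Function.ne_iff.1 ha
    refine Function.ne_iff.2 ⟨ρ i, ?_⟩
    simpa [sum_sub_distrib, hρ.ne_inv, hρ.injective.eq_iff] using hi
  · obtain ⟨j, -, hj⟩ := exists_ne_zero_of_sum_ne_zero hg
    refine ⟨j, ?_⟩
    by_contra! h
    simp [h.1, h.2] at hj

lemma finrank_ker_add_finrank_of_adjoint {K E F : Type*} [Field K] [AddCommGroup E] [Module K E]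
    [AddCommGroup F] [Module K F] [FiniteDimensional K E] [FiniteDimensional K F]
    {BE : LinearMap.BilinForm K E} {BF : LinearMap.BilinForm K F} (hE : BE.Nondegenerate)
    (hF : BF.Nondegenerate) {Φ : E →ₗ[K] F} {Ψ : F →ₗ[K] E} (h : ∀ a y, BF (Φ a) y = BE a (Ψ y)) :
    finrank K (LinearMap.ker Φ) + finrank K F = finrank K (LinearMap.ker Ψ) + finrank K E := by
  have ker_eq : LinearMap.ker Ψ = BF.orthogonal (LinearMap.range Φ) := by
    ext y
    rw [LinearMap.mem_ker, LinearMap.BilinForm.mem_orthogonal_iff]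
    constructor
    · rintro hy _ ⟨a, rfl⟩
      exact (h a y).trans (by rw [hy, map_zero])
    · exact fun hy => hE.2 _ fun a => by rw [← h]; exact hy _ ⟨a, rfl⟩
  have orthogonal := LinearMap.BilinForm.finrank_orthogonal hF (LinearMap.range Φ)
  have rank_nullity := Φ.finrank_range_add_finrank_ker
  have := (LinearMap.range Φ).finrank_le
  rw [ker_eq]
  omega

lemma piTraceForm_nondegenerate [Algebra.IsSeparable K L] :
    (piTraceForm K L ι).Nondegenerate := by
  classical
  have left : ∀ v : ι → L, (∀ w, piTraceForm K L ι v w = 0) → v = 0 := by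
    intro v hv
    ext i
    refine (traceForm_nondegenerate K L).1 _ fun y => ?_
    have := hv (Pi.single i y)
    rw [piTraceForm_apply, sum_eq_single i (fun j _ hj => by simp [hj]) (by simp)] at this
    simpa [Algebra.traceForm_apply] using this
  refine ⟨left, fun w hw => left w fun v => ?_⟩
  rw [← hw v, piTraceForm_apply, piTraceForm_apply]
  simp_rw [mul_comm]

end FiniteDimensional

end Polar

/-! ### Polar forms with prescribed vectors in the radical -/

section Radical

variable {K L ι κ : Type*} [Field K] [Field L] [Algebra K L]

/-- The evaluation `a ↦ (N_a(u_i))_i` of the polar operators at a family of vectors. -/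
def evalPolar [Fintype ι] (ρ : ι → L ≃ₐ[K] L) (u : κ → L) : (ι → L) →ₗ[K] (κ → L) where
  toFun a i := polarOp ρ a (u i)
  map_add' a b := by
    ext i
    simp only [polarOp_apply, Pi.add_apply, add_mul, map_add, ← sum_add_distrib]
    exact sum_congr rfl fun j _ => by ring
  map_smul' c a := by
    ext i
    simp only [polarOp_apply, Pi.smul_apply, smul_mul_assoc, map_smul, RingHom.id_apply, smul_sum,
      smul_sub]

lemma evalPolar_apply [Fintype ι] (ρ : ι → L ≃ₐ[K] L) (u : κ → L) (a : ι → L) (i : κ) :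
    evalPolar ρ u a i = polarOp ρ a (u i) := rfl

/-- The coefficients of the operator `x ↦ ∑_i (Tr(u_i x) y_i - Tr(y_i x) u_i)` as a combination of
automorphisms; see `galOp_altCoeff`. -/
def altCoeff [Fintype κ] (u y : κ → L) (g : L ≃ₐ[K] L) : L := ∑ i, (g (u i) * y i - u i * g (y i))

lemma altCoeff_one [Fintype κ] (u y : κ → L) : altCoeff u y (1 : L ≃ₐ[K] L) = 0 := by
  simp [altCoeff]

lemma apply_altCoeff_inv [Fintype κ] (u y : κ → L) (g : L ≃ₐ[K] L) :
    g (altCoeff u y g⁻¹) = -altCoeff u y g := by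
  have apply_inv_apply : ∀ z, g (g⁻¹ z) = z := g.apply_symm_apply
  simp only [altCoeff, map_sum, map_sub, map_mul, apply_inv_apply, ← sum_neg_distrib]
  exact sum_congr rfl fun i _ => by ring

/-- The adjoint of `evalPolar`. -/
def coPolar [Fintype κ] (ρ : ι → L ≃ₐ[K] L) (u : κ → L) : (κ → L) →ₗ[K] (ι → L) where
  toFun y j := altCoeff u y (ρ j)
  map_add' y z := by
    ext j
    simp only [altCoeff, Pi.add_apply, map_add, ← sum_add_distrib]
    exact sum_congr rfl fun i _ => by ring
  map_smul' c y := by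
    ext j
    simp only [altCoeff, Pi.smul_apply, mul_smul_comm, map_smul, RingHom.id_apply, smul_sum,
      smul_sub]

lemma coPolar_apply [Fintype κ] (ρ : ι → L ≃ₐ[K] L) (u y : κ → L) (j : ι) :
    coPolar ρ u y j = altCoeff u y (ρ j) := rfl

lemma piTraceForm_evalPolar [Fintype ι] [Fintype κ] (ρ : ι → L ≃ₐ[K] L) (u : κ → L) (a : ι → L)
    (y : κ → L) :
    piTraceForm K L κ (evalPolar ρ u a) y = piTraceForm K L ι a (coPolar ρ u y) := by
  simp only [piTraceForm_apply, evalPolar_apply, coPolar_apply, altCoeff, trace_polarOp_mul,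
    mul_sum, map_sum]
  exact sum_comm

/-- The families `i ↦ ∑_l M_{il} u_l` for symmetric matrices `M`. -/
def symCombination [Fintype κ] (K : Type*) [Field K] [Algebra K L] (u : κ → L) :
    (Sym2 κ → K) →ₗ[K] (κ → L) where
  toFun M i := ∑ l, M s(i, l) • u l
  map_add' M N := by
    ext i
    simp [add_smul, sum_add_distrib]
  map_smul' c M := by
    ext i
    simp [smul_sum, mul_smul]

lemma symCombination_apply [Fintype κ] (u : κ → L) (M : Sym2 κ → K) (i : κ) :
    symCombination K u M i = ∑ l, M s(i, l) • u l := rfl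

lemma symCombination_injective [Fintype κ] {u : κ → L} (hu : LinearIndependent K u) :
    Function.Injective (symCombination K u) := by
  rw [injective_iff_map_eq_zero]
  intro M hM
  ext z
  induction z using Sym2.ind with
  | _ i l => exact Fintype.linearIndependent_iff.1 hu (fun l => M s(i, l)) (congrFun hM i) l

lemma range_symCombination_le_ker_coPolar [Fintype κ] (ρ : ι → L ≃ₐ[K] L) (u : κ → L) :
    LinearMap.range (symCombination K u) ≤ LinearMap.ker (coPolar ρ u) := by
  rintro _ ⟨M, rfl⟩
  rw [LinearMap.mem_ker]
  ext j
  have expand : coPolar ρ u (symCombination K u M) j =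
      (∑ i, ∑ l, M s(i, l) • (ρ j (u i) * u l)) - ∑ i, ∑ l, M s(i, l) • (u i * ρ j (u l)) := by
    simp only [coPolar_apply, altCoeff, sum_sub_distrib, symCombination_apply, map_sum, map_smul,
      mul_sum, mul_smul_comm]
  rw [expand, sum_comm, Pi.zero_apply, sub_eq_zero]
  exact sum_congr rfl fun i _ => sum_congr rfl fun l _ => by rw [Sym2.eq_swap, mul_comm]

variable [FiniteDimensional K L]

lemma exists_trace_dual [DecidableEq κ] [Algebra.IsSeparable K L] {u : κ → L}
    (hu : LinearIndependent K u) :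
    ∃ x : κ → L, ∀ i j, Algebra.trace K L (u i * x j) = if i = j then 1 else 0 := by
  obtain ⟨g, hg⟩ := (Finsupp.linearCombination K u).exists_leftInverse_of_injective
    (LinearMap.ker_eq_bot.2 hu)
  have g_apply : ∀ i, g (u i) = Finsupp.single i 1 := fun i => by
    simpa using LinearMap.congr_fun hg (Finsupp.single i 1)
  have hB := traceForm_nondegenerate K L
  refine ⟨fun j => ((Algebra.traceForm K L).toDual hB).symm (Finsupp.lapply j ∘ₗ g), fun i j => ?_⟩
  have := LinearMap.BilinForm.apply_toDual_symm_apply (hB := hB) (f := Finsupp.lapply j ∘ₗ g)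
    (v := u i)
  rw [Algebra.traceForm_apply, mul_comm] at this
  rw [this, LinearMap.comp_apply, g_apply]
  simp [Finsupp.single_apply]

variable [Fintype κ]

lemma mem_range_symCombination [Algebra.IsSeparable K L] {u y : κ → L}
    (hu : LinearIndependent K u)
    (h : ∀ x, ∑ i, (Algebra.trace K L (u i * x) • y i - Algebra.trace K L (y i * x) • u i) = 0) :
    y ∈ LinearMap.range (symCombination K u) := by
  classical
  obtain ⟨x, hx⟩ := exists_trace_dual hu
  have expansion : ∀ j, y j = ∑ i, Algebra.trace K L (y i * x j) • u i := by
    intro j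
    have := h (x j)
    simpa [sum_sub_distrib, hx, ite_smul, sub_eq_zero] using this
  have symm : ∀ i j, Algebra.trace K L (y i * x j) = Algebra.trace K L (y j * x i) := by
    intro i j
    conv_lhs => rw [expansion i]
    simp [sum_mul, hx]
  refine ⟨Sym2.lift ⟨fun i j => Algebra.trace K L (y i * x j), symm⟩, ?_⟩
  ext i
  rw [symCombination_apply, expansion i]
  exact sum_congr rfl fun l _ => by rw [Sym2.lift_mk, symm]

lemma finrank_le_finrank_ker_add_card {K V V' : Type*} [Field K] [AddCommGroup V] [Module K V]
    [AddCommGroup V'] [Module K V'] [FiniteDimensional K V] (φ : κ → Dual K V) {f : V →ₗ[K] V'}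
    (h : ∀ x, (∀ i, φ i x = 0) → f x = 0) :
    finrank K V ≤ finrank K (LinearMap.ker f) + Fintype.card κ := by
  have ker_le : LinearMap.ker (LinearMap.pi φ) ≤ LinearMap.ker f := fun x hx =>
    h x (congrFun (LinearMap.mem_ker.1 hx))
  have range_le : finrank K (LinearMap.range (LinearMap.pi φ)) ≤ Fintype.card κ := by
    simpa using (LinearMap.range (LinearMap.pi φ)).finrank_le
  have := Submodule.finrank_mono ker_le
  have := (LinearMap.pi φ).finrank_range_add_finrank_ker
  omega

variable [IsGalois K L]

lemma galOp_altCoeff (u y : κ → L) (x : L) :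
    galOp (altCoeff (K := K) u y) x =
      ∑ i, (Algebra.trace K L (u i * x) • y i - Algebra.trace K L (y i * x) • u i) := by
  rw [galOp_apply]
  simp only [altCoeff, Algebra.smul_def, trace_eq_sum_automorphisms, sum_mul, map_mul]
  rw [sum_comm]
  refine sum_congr rfl fun i _ => ?_
  rw [← sum_sub_distrib]
  exact sum_congr rfl fun g _ => by ring

lemma finrank_le_finrank_ker_galOp_altCoeff_add (u y : κ → L) :
    finrank K L ≤ finrank K (LinearMap.ker (galOp (altCoeff (K := K) u y))) +
      2 * Fintype.card κ := by
  rw [two_mul, ← Fintype.card_sum]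
  refine finrank_le_finrank_ker_add_card
    (Sum.elim (fun i => Algebra.traceForm K L (u i)) fun i => Algebra.traceForm K L (y i))
    fun x hx => ?_
  have hu : ∀ i, Algebra.trace K L (u i * x) = 0 := fun i => hx (Sum.inl i)
  have hy : ∀ i, Algebra.trace K L (y i * x) = 0 := fun i => hx (Sum.inr i)
  simp [galOp_altCoeff, hu, hy]

variable [Fintype ι] {ρ : ι → L ≃ₐ[K] L}

lemma IsGoldSystem.altCoeff_eq_zero (hρ : IsGoldSystem ρ)
    (hκ : Fintype.card κ ≤ Fintype.card ι) {u y : κ → L} (hy : coPolar ρ u y = 0) :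
    altCoeff u y = (0 : (L ≃ₐ[K] L) → L) := by
  have vanish : ∀ j, altCoeff u y (ρ j) = 0 := congrFun hy
  by_contra hC
  have upper := hρ.cothin (altCoeff u y) hC ?_
  · have lower := finrank_le_finrank_ker_galOp_altCoeff_add (K := K) u y
    have := hρ.two_mul_card_lt
    omega
  · rintro g hg (rfl | ⟨j, rfl | rfl⟩)
    · exact hg (altCoeff_one u y)
    · exact hg (vanish j)
    · refine hg ((map_eq_zero_iff _ (ρ j).injective).1 ?_)
      rw [apply_altCoeff_inv, vanish, neg_zero]

lemma IsGoldSystem.ker_coPolar (hρ : IsGoldSystem ρ)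
    (hκ : Fintype.card κ ≤ Fintype.card ι) {u : κ → L} (hu : LinearIndependent K u) :
    LinearMap.ker (coPolar ρ u) = LinearMap.range (symCombination K u) := by
  refine le_antisymm (fun y hy => mem_range_symCombination hu fun x => ?_)
    (range_symCombination_le_ker_coPolar ρ u)
  rw [← galOp_altCoeff, hρ.altCoeff_eq_zero hκ hy, galOp_apply]
  simp

theorem IsGoldSystem.finrank_ker_evalPolar (hρ : IsGoldSystem ρ)
    (hκ : Fintype.card κ ≤ Fintype.card ι) {u : κ → L} (hu : LinearIndependent K u) :
    finrank K (LinearMap.ker (evalPolar ρ u)) + Fintype.card κ * finrank K L =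
      (Fintype.card κ + 1).choose 2 + Fintype.card ι * finrank K L := by
  classical
  have := finrank_ker_add_finrank_of_adjoint (piTraceForm_nondegenerate (K := K) (L := L))
    (piTraceForm_nondegenerate (K := K) (L := L)) (piTraceForm_evalPolar ρ u)
  rw [hρ.ker_coPolar hκ hu, LinearMap.finrank_range_of_inj (symCombination_injective hu),
    finrank_fintype_fun_eq_card, Sym2.card, finrank_pi_fintype, finrank_pi_fintype] at this
  simpa using this

end Radical

/-! ### The rank distribution of the polar forms -/

section Moments

lemma natCard_linearIndependent_eq_prod (K V : Type*) [Field K] [AddCommGroup V] [Module K V]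
    [Finite K] [Finite V] (r : ℕ) :
    (Nat.card {s : Fin r → V // LinearIndependent K s} : ℚ) =
      ∏ l ∈ range r, ((Nat.card K : ℚ) ^ finrank K V - (Nat.card K : ℚ) ^ l) := by
  have := Fintype.ofFinite K
  rcases le_or_gt r (finrank K V) with h | h
  · rw [card_linearIndependent h, Nat.cast_prod, prod_range, Nat.card_eq_fintype_card]
    refine prod_congr rfl fun i _ => ?_
    rw [Nat.cast_sub (Nat.pow_le_pow_right Fintype.card_pos (by omega)), Nat.cast_pow,
      Nat.cast_pow]
  · rw [prod_eq_zero (mem_range.2 h) (sub_self _)]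
    have : IsEmpty {s : Fin r → V // LinearIndependent K s} :=
      ⟨fun s => by simpa using s.2.fintype_card_le_finrank.trans_lt h⟩
    simp

/-- Linearly independent families in a submodule as families in the ambient module. -/
def linearIndependentSubmoduleEquiv {K V : Type*} [Field K] [AddCommGroup V] [Module K V]
    (W : Submodule K V) (κ : Type*) :
    {s : κ → W // LinearIndependent K s} ≃
      {u : κ → V // LinearIndependent K u ∧ ∀ i, u i ∈ W} where
  toFun s := ⟨W.subtype ∘ s.1, (LinearMap.linearIndependent_iff _ W.ker_subtype).2 s.2,
    fun i => (s.1 i).2⟩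
  invFun u := ⟨fun i => ⟨u.1 i, u.2.2 i⟩,
    (LinearMap.linearIndependent_iff W.subtype W.ker_subtype).1 u.2.1⟩

lemma prod_pow_succ {R : Type*} [CommMonoid R] (q : R) (r : ℕ) :
    ∏ l ∈ range r, q ^ (l + 1) = q ^ (r + 1).choose 2 := by
  induction r with
  | zero => simp
  | succ r ih =>
    rw [prod_range_succ, ih, ← pow_add, Nat.choose_succ_succ' (r + 1) 1, Nat.choose_one_right,
      add_comm]

variable {K L ι : Type*} [Field K] [Finite K] [Field L] [Fintype L] [Algebra K L] [Fintype ι]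

open Classical in
lemma prod_card_ker_polarOp_sub_pow (ρ : ι → L ≃ₐ[K] L) (a : ι → L) (r : ℕ) :
    ∏ l ∈ range r,
        ((Nat.card K : ℚ) ^ finrank K (LinearMap.ker (polarOp ρ a)) - (Nat.card K : ℚ) ^ l) =
      #{u : Fin r → L | LinearIndependent K u ∧ evalPolar ρ u a = 0} := by
  rw [← natCard_linearIndependent_eq_prod,
    Nat.card_congr (linearIndependentSubmoduleEquiv _ (Fin r)), Nat.card_eq_fintype_card,
    Fintype.card_subtype]
  congr 2
  ext u
  simp [funext_iff, evalPolar_apply]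

lemma IsGoldSystem.card_evalPolar_eq_zero [DecidableEq ι] [DecidableEq L] {ρ : ι → L ≃ₐ[K] L}
    (hρ : IsGoldSystem ρ) {r : ℕ} (hr : r ≤ Fintype.card ι) {u : Fin r → L}
    (hu : LinearIndependent K u) :
    (#{a : ι → L | evalPolar ρ u a = 0} : ℚ) =
      (Nat.card K : ℚ) ^ (finrank K L * Fintype.card ι) *
        (∏ l ∈ range r, (Nat.card K : ℚ) ^ (l + 1)) * (((Nat.card K : ℚ) ^ finrank K L)⁻¹) ^ r := by
  have hq : (Nat.card K : ℚ) ≠ 0 := by exact_mod_cast Nat.card_pos.ne'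
  have card_eq : #{a : ι → L | evalPolar ρ u a = 0} =
      Nat.card K ^ finrank K (LinearMap.ker (evalPolar ρ u)) := by
    rw [← Module.natCard_eq_pow_finrank, ← Fintype.card_subtype, ← Nat.card_eq_fintype_card]
    rfl
  have dimension := hρ.finrank_ker_evalPolar (by simpa using hr) hu
  rw [Fintype.card_fin] at dimension
  rw [card_eq, Nat.cast_pow, prod_pow_succ, inv_pow, ← pow_mul, ← pow_add,
    eq_mul_inv_iff_mul_eq₀ (pow_ne_zero _ hq), ← pow_add]
  congr 1
  linarith

/-- Double counting of the pairs `(a, u)` with `u` an independent family in the radical of `a`. -/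
theorem IsGoldSystem.sum_prod_card_ker_sub_pow [DecidableEq ι] {ρ : ι → L ≃ₐ[K] L}
    (hρ : IsGoldSystem ρ) {r : ℕ} (hr : r ≤ Fintype.card ι) :
    ∑ a : ι → L, ∏ l ∈ range r,
        ((Nat.card K : ℚ) ^ finrank K (LinearMap.ker (polarOp ρ a)) - (Nat.card K : ℚ) ^ l) =
      (Nat.card K : ℚ) ^ (finrank K L * Fintype.card ι) * ∏ l ∈ range r,
        ((Nat.card K : ℚ) ^ (l + 1) *
          (1 - (Nat.card K : ℚ) ^ l * ((Nat.card K : ℚ) ^ finrank K L)⁻¹)) := by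
  classical
  have hn : (Nat.card K : ℚ) ^ finrank K L ≠ 0 :=
    pow_ne_zero _ (by exact_mod_cast Nat.card_pos.ne')
  have double_count : ∑ a : ι → L, #{u : Fin r → L | LinearIndependent K u ∧ evalPolar ρ u a = 0} =
      ∑ u : Fin r → L with LinearIndependent K u, #{a : ι → L | evalPolar ρ u a = 0} := by
    simp_rw [← filter_filter]
    exact sum_card_bipartiteAbove_eq_sum_card_bipartiteBelow fun a u => evalPolar ρ u a = 0
  have card_independent : (#{u : Fin r → L | LinearIndependent K u} : ℚ) =
      ∏ l ∈ range r, ((Nat.card K : ℚ) ^ finrank K L - (Nat.card K : ℚ) ^ l) := by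
    rw [← natCard_linearIndependent_eq_prod, Nat.card_eq_fintype_card, Fintype.card_subtype]
  have factor_out := pow_mul_prod_one_sub_mul_inv hn (fun l => (Nat.card K : ℚ) ^ l) le_rfl (j := r)
  rw [Nat.sub_self, pow_zero, one_mul] at factor_out
  simp_rw [prod_card_ker_polarOp_sub_pow]
  rw [← Nat.cast_sum, double_count, Nat.cast_sum, sum_congr rfl fun u hu =>
    hρ.card_evalPolar_eq_zero hr (u := u) (mem_filter.1 hu).2, sum_const, nsmul_eq_mul,
    card_independent, ← factor_out, prod_mul_distrib, inv_pow]
  field_simp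

end Moments

section EvenRank

lemma exists_orthogonal_eq_self {K V : Type*} [Field K] [AddCommGroup V] [Module K V]
    [FiniteDimensional K V] {B : LinearMap.BilinForm K V} (hB : B.IsAlt) :
    ∃ W, B.orthogonal W = W := by
  obtain ⟨W, hW, hmax⟩ := (wellFounded_gt (α := Submodule K V)).has_min
    {W | W ≤ B.orthogonal W} ⟨⊥, by simp⟩
  refine ⟨W, le_antisymm (fun v hv => ?_) hW⟩
  by_contra hvW
  refine hmax (W ⊔ Submodule.span K {v}) ?_ (lt_of_le_of_ne le_sup_left fun h =>
    hvW (h ▸ Submodule.mem_sup_right (Submodule.mem_span_singleton_self v)))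
  intro x hx y hy
  obtain ⟨w, hw, z, hz, rfl⟩ := Submodule.mem_sup.1 hx
  obtain ⟨w', hw', z', hz', rfl⟩ := Submodule.mem_sup.1 hy
  obtain ⟨c, rfl⟩ := Submodule.mem_span_singleton.1 hz
  obtain ⟨c', rfl⟩ := Submodule.mem_span_singleton.1 hz'
  have hww : B w' w = 0 := hW hw w' hw'
  have hwv : B w' v = 0 := hv w' hw'
  have hvw : B v w = 0 := hB.isRefl _ _ (hv w hw)
  have hvv : B v v = 0 := hB v
  simp [hww, hwv, hvw, hvv]

lemma even_finrank_add_finrank_orthogonal_top {K V : Type*} [Field K] [AddCommGroup V] [Module K V]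
    [FiniteDimensional K V] {B : LinearMap.BilinForm K V} (hB : B.IsAlt) :
    Even (finrank K V + finrank K (B.orthogonal ⊤)) := by
  obtain ⟨W, hW⟩ := exists_orthogonal_eq_self hB
  have radical_le : B.orthogonal ⊤ ≤ W := by
    rw [← hW]
    exact LinearMap.BilinForm.orthogonal_le le_top
  have := LinearMap.BilinForm.finrank_add_finrank_orthogonal hB.isRefl W
  rw [hW, inf_eq_right.2 radical_le] at this
  exact ⟨finrank K W, this.symm⟩

lemma even_finrank_add_finrank_ker {K L : Type*} [Field K] [Field L] [Algebra K L]
    [FiniteDimensional K L] [Algebra.IsSeparable K L] {N : L →ₗ[K] L}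
    (hN : ∀ x, Algebra.trace K L (N x * x) = 0) :
    Even (finrank K L + finrank K (LinearMap.ker N)) := by
  let B : LinearMap.BilinForm K L := Algebra.traceForm K L ∘ₗ N
  have isAlt : B.IsAlt := hN
  have ker_eq : B.orthogonal ⊤ = LinearMap.ker N := by
    ext x
    rw [LinearMap.BilinForm.mem_orthogonal_iff, LinearMap.mem_ker]
    refine ⟨fun hx => (traceForm_nondegenerate K L).1 _ fun y => isAlt.isRefl _ _ (hx y trivial),
      fun hx y _ => isAlt.isRefl _ _ ?_⟩
    rw [LinearMap.comp_apply, hx, map_zero, LinearMap.zero_apply]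
  rw [← ker_eq]
  exact even_finrank_add_finrank_orthogonal_top isAlt

end EvenRank

section RankDistribution

variable {K L ι : Type*} [Field K] [Field L] [Algebra K L] [Fintype ι]

lemma odd_finrank_ker_polarOp [FiniteDimensional K L] [Algebra.IsSeparable K L]
    (hn : Odd (finrank K L)) (ρ : ι → L ≃ₐ[K] L) (a : ι → L) :
    Odd (finrank K (LinearMap.ker (polarOp ρ a))) := by
  refine (Nat.even_add'.1 (even_finrank_add_finrank_ker fun x => ?_)).1 hn
  rw [trace_polarOp_mul]
  exact sum_eq_zero fun j _ => by rw [mul_comm x, sub_self, mul_zero, map_zero]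

variable [Finite K]

lemma IsGoldSystem.sum_gaussBinom_finrank_ker [Fintype L] [DecidableEq ι] [DecidableEq L]
    {ρ : ι → L ≃ₐ[K] L} (hρ : IsGoldSystem ρ) {h : ℕ} (hn : finrank K L = 2 * h + 1) {j : ℕ}
    (hj : j ≤ Fintype.card ι) :
    ∑ a : ι → L with a ≠ 0, gaussBinom ((Nat.card K : ℚ) ^ 2)
        (finrank K (LinearMap.ker (polarOp ρ a)) / 2) j =
      gaussBinom ((Nat.card K : ℚ) ^ 2) h j *
        ((Nat.card K : ℚ) ^ (finrank K L * (Fintype.card ι - j)) - 1) := by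
  have hq : (1 : ℚ) < Nat.card K := by exact_mod_cast Finite.one_lt_card
  have two_mul_half_add_one : ∀ a, 2 * (finrank K (LinearMap.ker (polarOp ρ a)) / 2) + 1 =
      finrank K (LinearMap.ker (polarOp ρ a)) := fun a =>
    Nat.two_mul_div_two_add_one_of_odd (odd_finrank_ker_polarOp ⟨h, hn⟩ ρ a)
  have total := sum_gaussBinom_sq univ (fun a => finrank K (LinearMap.ker (polarOp ρ a)) / 2)
    (h := h) hq (fun r hr => by
      simpa only [two_mul_half_add_one, hn] using hρ.sum_prod_card_ker_sub_pow hr) hj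
  have at_zero : finrank K (LinearMap.ker (polarOp ρ 0)) / 2 = h := by
    rw [polarOp_zero, LinearMap.ker_zero, finrank_top, hn]
    omega
  rw [← add_sum_erase _ _ (mem_univ 0), at_zero, ← hn] at total
  rw [filter_ne']
  linear_combination total

theorem IsGoldSystem.card_finrank_ker_eq [Finite L] {ρ : ι → L ≃ₐ[K] L} (hρ : IsGoldSystem ρ)
    {h : ℕ} (hn : finrank K L = 2 * h + 1) {i : ℕ} (hi : i < Fintype.card ι) :
    (Nat.card {a : ι → L // finrank K (LinearMap.ker (polarOp ρ a)) = 2 * i + 1} : ℚ) =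
      ∑ j ∈ Icc i (Fintype.card ι - 1),
        (-1) ^ (j - i) * ((Nat.card K : ℚ) ^ 2) ^ (j - i).choose 2 *
          gaussBinom ((Nat.card K : ℚ) ^ 2) j i *
          (gaussBinom ((Nat.card K : ℚ) ^ 2) h j *
            ((Nat.card K : ℚ) ^ (finrank K L * (Fintype.card ι - j)) - 1)) := by
  classical
  have := Fintype.ofFinite L
  let x (a : ι → L) : ℕ := finrank K (LinearMap.ker (polarOp ρ a)) / 2
  let A (y : ℕ) : ℚ := #{a : ι → L | a ≠ 0 ∧ x a = y}
  have x_lt : ∀ a, a ≠ 0 → x a < Fintype.card ι := fun a ha => by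
    have := hρ.finrank_ker_polarOp_le ha
    have := odd_finrank_ker_polarOp ⟨h, hn⟩ ρ a
    grind
  have moments : ∀ j ≤ Fintype.card ι - 1,
      ∑ y ∈ range (Fintype.card ι - 1 + 1), A y * gaussBinom ((Nat.card K : ℚ) ^ 2) y j =
        gaussBinom ((Nat.card K : ℚ) ^ 2) h j *
          ((Nat.card K : ℚ) ^ (finrank K L * (Fintype.card ι - j)) - 1) := by
    intro j hj
    rw [← hρ.sum_gaussBinom_finrank_ker hn (by lia), Nat.sub_add_cancel (by lia),
      ← sum_fiberwise_of_maps_to (g := x) fun a ha => mem_range.2 (x_lt a (mem_filter.1 ha).2)]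
    refine sum_congr rfl fun y _ => ?_
    rw [filter_filter, ← nsmul_eq_mul, ← sum_const]
    exact sum_congr rfl fun a ha => by rw [← (mem_filter.1 ha).2.2]
  have card_eq :
      Nat.card {a : ι → L // finrank K (LinearMap.ker (polarOp ρ a)) = 2 * i + 1} = A i := by
    rw [Nat.card_eq_fintype_card, Fintype.card_subtype]
    congr 2
    ext a
    have := odd_finrank_ker_polarOp ⟨h, hn⟩ ρ a
    have ne_zero : finrank K (LinearMap.ker (polarOp ρ a)) = 2 * i + 1 → a ≠ 0 := by
      rintro hi' rfl
      have := hρ.two_mul_card_lt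
      rw [polarOp_zero, LinearMap.ker_zero, finrank_top] at hi'
      lia
    grind
  have hq : (1 : ℚ) < Nat.card K := by exact_mod_cast Finite.one_lt_card
  rw [card_eq, gaussBinom_inversion (one_lt_pow₀ hq two_ne_zero) moments (by lia)]

end RankDistribution

/-! ### Exponential sums of quadratic phases -/

section QuadraticPhase

variable {K L : Type*} [Field K] [Field L] [Algebra K L]

/-- `Φ` is `±1`-valued and multiplicative up to the bicharacter `(x, y) ↦ ψ (N x * y)`: the sign
of a quadratic form whose polar form is represented by the operator `N`. -/
structure IsQuadraticPhase (ψ : AddChar L ℤ) (Φ : L → ℤ) (N : L →ₗ[K] L) : Prop where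
  mul_self : ∀ x, Φ x * Φ x = 1
  map_add : ∀ x y, Φ (x + y) = Φ x * Φ y * ψ (N x * y)

/-- The Walsh transform of `Φ` with respect to the additive character `ψ`. -/
def walsh [Fintype L] (ψ : AddChar L ℤ) (Φ : L → ℤ) (b : L) : ℤ := ∑ x, Φ x * ψ (b * x)

variable {ψ : AddChar L ℤ} {Φ : L → ℤ} {N : L →ₗ[K] L}

namespace IsQuadraticPhase

lemma map_zero (hΦ : IsQuadraticPhase ψ Φ N) : Φ 0 = 1 := by
  have := hΦ.map_add 0 0
  rwa [add_zero, mul_zero, AddChar.map_zero_eq_one, mul_one, hΦ.mul_self] at this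

/-- A twisted quadratic phase restricts to a character of the radical of its polar form. -/
def charOnKer (hΦ : IsQuadraticPhase ψ Φ N) (b : L) : AddChar (LinearMap.ker N) ℤ where
  toFun z := Φ z * ψ (b * z)
  map_zero_eq_one' := by simp [hΦ.map_zero]
  map_add_eq_mul' y z := by
    have hy : N y = 0 := y.2
    rw [Submodule.coe_add, hΦ.map_add, hy, zero_mul, AddChar.map_zero_eq_one, mul_add,
      AddChar.map_add_eq_mul]
    ring

end IsQuadraticPhase

variable [Fintype L]

lemma sum_walsh (hψ : ψ.IsPrimitive) (Φ : L → ℤ) : ∑ b, walsh ψ Φ b = Fintype.card L * Φ 0 := by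
  classical
  simp_rw [walsh]
  rw [sum_comm]
  simp_rw [← mul_sum, AddChar.sum_mulShift _ hψ]
  simp [mul_comm]

variable [CharP L 2]

lemma sum_walsh_sq (hψ : ψ.IsPrimitive) (hΦ : ∀ x, Φ x * Φ x = 1) :
    ∑ b, walsh ψ Φ b ^ 2 = (Fintype.card L : ℤ) ^ 2 := by
  classical
  calc ∑ b, walsh ψ Φ b ^ 2
      = ∑ b, ∑ x, ∑ y, Φ x * Φ y * ψ (b * (x + y)) := by
        refine sum_congr rfl fun b _ => ?_
        rw [sq, walsh, sum_mul_sum]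
        refine sum_congr rfl fun x _ => sum_congr rfl fun y _ => ?_
        rw [mul_add, AddChar.map_add_eq_mul]
        ring
    _ = ∑ x, ∑ y, Φ x * Φ y * ∑ b, ψ (b * (x + y)) := by
        rw [sum_comm]
        simp_rw [mul_sum]
        exact sum_congr rfl fun x _ => sum_comm
    _ = ∑ _x : L, (Fintype.card L : ℤ) := by
        simp [AddChar.sum_mulShift _ hψ, CharTwo.add_eq_zero, hΦ]
    _ = (Fintype.card L : ℤ) ^ 2 := by simp [sq]

namespace IsQuadraticPhase

lemma walsh_sq (hΦ : IsQuadraticPhase ψ Φ N) (hψ : ψ.IsPrimitive) (b : L)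
    [Fintype (LinearMap.ker N)] :
    walsh ψ Φ b ^ 2 = Fintype.card L * ∑ z, hΦ.charOnKer b z := by
  classical
  have hψ2 (x : L) : ψ x * ψ x = 1 := by
    rw [← AddChar.map_add_eq_mul, CharTwo.add_self_eq_zero, AddChar.map_zero_eq_one]
  have translate (x z : L) : Φ (z + x) * ψ (b * (z + x)) * (Φ x * ψ (b * x)) =
      Φ z * ψ (b * z) * ψ (x * N z) := by
    rw [hΦ.map_add, mul_add, AddChar.map_add_eq_mul, mul_comm x]
    linear_combination Φ z * ψ (b * z) * ψ (N z * x) *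
      (ψ (b * x) * ψ (b * x) * hΦ.mul_self x + hψ2 (b * x))
  calc walsh ψ Φ b ^ 2
      = ∑ x, ∑ z, Φ (z + x) * ψ (b * (z + x)) * (Φ x * ψ (b * x)) := by
        rw [sq, walsh, sum_mul_sum, sum_comm]
        exact sum_congr rfl fun x _ =>
          (Equiv.sum_comp (Equiv.addRight x) fun y => Φ y * ψ (b * y) * (Φ x * ψ (b * x))).symm
    _ = ∑ z, Φ z * ψ (b * z) * ∑ x, ψ (x * N z) := by
        simp_rw [translate, mul_sum]
        exact sum_comm
    _ = ∑ z with N z = 0, (Fintype.card L : ℤ) * (Φ z * ψ (b * z)) := by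
        simp [AddChar.sum_mulShift _ hψ, sum_filter, mul_comm]
    _ = Fintype.card L * ∑ z, hΦ.charOnKer b z := by
        rw [mul_sum]
        exact sum_subtype (p := (· ∈ LinearMap.ker N)) _ (by simp) _

lemma walsh_sq_eq_zero_or (hΦ : IsQuadraticPhase ψ Φ N) (hψ : ψ.IsPrimitive) (b : L) :
    walsh ψ Φ b ^ 2 = 0 ∨ walsh ψ Φ b ^ 2 = Fintype.card L * Nat.card (LinearMap.ker N) := by
  classical
  rw [hΦ.walsh_sq hψ, AddChar.sum_eq_ite, Nat.card_eq_fintype_card]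
  split_ifs <;> simp

lemma two_mul_card_walsh_eq (hΦ : IsQuadraticPhase ψ Φ N) (hψ : ψ.IsPrimitive) {T t ε : ℤ}
    (hT : T ≠ 0) (hTt : (Fintype.card L : ℤ) = T * t)
    (hsq : (Fintype.card L : ℤ) * Nat.card (LinearMap.ker N) = T ^ 2) (hε : ε * ε = 1) :
    2 * (Nat.card {b // walsh ψ Φ b = ε * T} : ℤ) = t ^ 2 + ε * t := by
  -- The values of the transform are `0` and `±T`, so this polynomial detects the value `ε * T`.
  have indicator : ∀ b, walsh ψ Φ b ^ 2 + ε * T * walsh ψ Φ b =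
      2 * T ^ 2 * (if walsh ψ Φ b = ε * T then 1 else 0) := by
    intro b
    split_ifs with h
    · rw [h]
      linear_combination (2 * T ^ 2) * hε
    · rcases hΦ.walsh_sq_eq_zero_or hψ b with zero | square
      · rw [zero, pow_eq_zero_iff two_ne_zero |>.1 zero]
        ring
      · have factors : (walsh ψ Φ b - ε * T) * (walsh ψ Φ b + ε * T) = 0 := by
          linear_combination square + hsq - T ^ 2 * hε
        linear_combination walsh ψ Φ b * (mul_eq_zero.1 factors).resolve_left (sub_ne_zero.2 h)
  have total : ∑ b, (walsh ψ Φ b ^ 2 + ε * T * walsh ψ Φ b) =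
      (T * t) ^ 2 + ε * T * (T * t) := by
    rw [sum_add_distrib, ← mul_sum, sum_walsh_sq hψ hΦ.mul_self, sum_walsh hψ, hΦ.map_zero, hTt,
      mul_one]
  simp_rw [indicator] at total
  rw [← mul_sum, sum_boole] at total
  rw [Nat.card_eq_fintype_card, Fintype.card_subtype]
  apply mul_left_cancel₀ (pow_ne_zero 2 hT)
  linear_combination total

lemma card_mul_card_ker_eq_of_walsh_eq (hΦ : IsQuadraticPhase ψ Φ N) (hψ : ψ.IsPrimitive)
    {T ε : ℤ} (hT : T ≠ 0) (hε : ε * ε = 1) {b : L} (hb : walsh ψ Φ b = ε * T) :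
    (Fintype.card L : ℤ) * Nat.card (LinearMap.ker N) = T ^ 2 := by
  have walsh_sq : walsh ψ Φ b ^ 2 = T ^ 2 := by
    rw [hb]
    linear_combination T ^ 2 * hε
  rcases hΦ.walsh_sq_eq_zero_or hψ b with zero | square
  · exact absurd (walsh_sq.symm.trans zero) (pow_ne_zero 2 hT)
  · exact square.symm.trans walsh_sq

end IsQuadraticPhase

end QuadraticPhase

section TraceSign

/-- The nontrivial additive character of `ZMod 2`, with values `±1`. -/
def sign : AddChar (ZMod 2) ℤ := AddChar.zmodChar 2 (ζ := -1) (by norm_num)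

lemma sign_apply (z : ZMod 2) : sign z = (-1) ^ z.val := rfl

lemma sign_mul_self (z : ZMod 2) : sign z * sign z = 1 := by
  rw [← AddChar.map_add_eq_mul, CharTwo.add_self_eq_zero, AddChar.map_zero_eq_one]

/-- The additive character `x ↦ (-1) ^ Tr x` of a field of characteristic two. -/
noncomputable def traceSign (L : Type*) [Field L] [Algebra (ZMod 2) L] : AddChar L ℤ :=
  sign.compAddMonoidHom (Algebra.trace (ZMod 2) L).toAddMonoidHom

lemma traceSign_apply {L : Type*} [Field L] [Algebra (ZMod 2) L] (x : L) :
    traceSign L x = sign (Algebra.trace (ZMod 2) L x) := rfl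

lemma traceSign_isPrimitive (L : Type*) [Field L] [Finite L] [Algebra (ZMod 2) L] :
    (traceSign L).IsPrimitive := by
  intro b hb trivial
  refine hb ((traceForm_nondegenerate (ZMod 2) L).1 b fun x => ?_)
  have sign_injective : Function.Injective sign := by decide
  apply sign_injective
  rw [AddChar.map_zero_eq_one]
  exact DFunLike.congr_fun trivial x

end TraceSign

/-! ### The field generated by a maximum-length sequence -/

section Register

variable {n : ℕ}

lemma shift_ne_zero {s : BinSeq n} (hs : s ≠ 0) (u : ZMod n) : shift u s ≠ 0 := fun h =>
  hs <| funext fun t => by simpa [shift] using congrFun h (t - u)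

/-- The shift by one place as an operator. -/
def shiftOp (n : ℕ) : End (ZMod 2) (BinSeq n) := LinearMap.funLeft (ZMod 2) (ZMod 2) (· + 1)

lemma shiftOp_pow_apply (u : ℕ) (w : BinSeq n) : (shiftOp n ^ u) w = shift (u : ZMod n) w := by
  induction u with
  | zero => ext t; simp [shift]
  | succ u ih =>
    rw [pow_succ', End.mul_apply, ih]
    ext t
    simp [shiftOp, LinearMap.funLeft_apply, shift, add_comm, add_left_comm]

/-- The sequences satisfying the linear recurrence with coefficients `a`. -/
def recurrenceSpace (n : ℕ) {m : ℕ} (a : Fin m → ZMod 2) : Submodule (ZMod 2) (BinSeq n) where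
  carrier := {w | ∀ t, w (t + (m : ZMod n)) = ∑ l : Fin m, a l * w (t + ((l : ℕ) : ZMod n))}
  add_mem' {v w} hv hw t := by
    simp only [Pi.add_apply, mul_add, sum_add_distrib, hv t, hw t]
  zero_mem' t := by simp
  smul_mem' c w hw t := by
    simp only [Pi.smul_apply, smul_eq_mul, hw t, mul_sum, mul_left_comm]

variable {m : ℕ} {a : Fin m → ZMod 2}

lemma aeval_shiftOp_mem_recurrenceSpace {w : BinSeq n} (hw : w ∈ recurrenceSpace n a)
    (f : (ZMod 2)[X]) : aeval (shiftOp n) f w ∈ recurrenceSpace n a := by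
  refine aeval_apply_smul_mem_of_le_comap hw f _ fun v hv t => ?_
  simp only [shiftOp, LinearMap.funLeft_apply]
  rw [add_right_comm, hv (t + 1)]
  exact sum_congr rfl fun l _ => by rw [add_right_comm]

lemma eq_zero_of_mem_recurrenceSpace [NeZero n] {w : BinSeq n} (hw : w ∈ recurrenceSpace n a)
    (h0 : ∀ l : Fin m, w ((l : ℕ) : ZMod n) = 0) : w = 0 := by
  suffices ∀ t : ℕ, w (t : ZMod n) = 0 by
    ext t
    rw [← ZMod.natCast_zmod_val t]
    exact this _
  intro t
  induction t using Nat.strong_induction_on with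
  | _ t ih =>
    rcases lt_or_ge t m with h | h
    · exact h0 ⟨t, h⟩
    · obtain ⟨v, rfl⟩ := Nat.exists_eq_add_of_le' h
      rw [Nat.cast_add, hw v]
      refine sum_eq_zero fun l _ => ?_
      rw [← Nat.cast_add, ih (v + l) (by lia), mul_zero]

lemma natCard_recurrenceSpace_le [NeZero n] (a : Fin m → ZMod 2) :
    Nat.card (recurrenceSpace n a) ≤ 2 ^ m := by
  let initialValues : recurrenceSpace n a →ₗ[ZMod 2] Fin m → ZMod 2 :=
    LinearMap.funLeft (ZMod 2) (ZMod 2) (fun l : Fin m => ((l : ℕ) : ZMod n)) ∘ₗ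
      (recurrenceSpace n a).subtype
  have injective : Function.Injective initialValues :=
    (injective_iff_map_eq_zero _).2 fun w hw =>
      Subtype.ext (eq_zero_of_mem_recurrenceSpace w.2 (congrFun hw))
  simpa using Nat.card_le_card_of_injective _ injective

/-- The annihilator of a sequence under the shift operator. -/
noncomputable def annIdeal (s : BinSeq n) : Ideal (ZMod 2)[X] :=
  Ideal.torsionOf _ (AEval' (shiftOp n)) (AEval'.of (shiftOp n) s)

lemma mem_annIdeal {s : BinSeq n} {f : (ZMod 2)[X]} :
    f ∈ annIdeal s ↔ aeval (shiftOp n) f s = 0 := by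
  rw [annIdeal, Ideal.mem_torsionOf_iff, ← AEval.of_aeval_smul]
  exact EmbeddingLike.map_eq_zero_iff

lemma aeval_X_pow_shiftOp (s : BinSeq n) (u : ℕ) :
    aeval (shiftOp n) (X ^ u : (ZMod 2)[X]) s = shift (u : ZMod n) s := by
  rw [map_pow, aeval_X, shiftOp_pow_apply]

lemma X_pow_sub_one_mem_annIdeal {s : BinSeq n} {u : ℕ} :
    (X ^ u - 1 : (ZMod 2)[X]) ∈ annIdeal s ↔ shift (u : ZMod n) s = s := by
  rw [mem_annIdeal, map_sub, LinearMap.sub_apply, aeval_X_pow_shiftOp, map_one, End.one_apply,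
    sub_eq_zero]

lemma exists_functional_quotient_annIdeal (s : BinSeq n) :
    ∃ φ : (ZMod 2)[X] ⧸ annIdeal s →ₗ[ZMod 2] ZMod 2,
      ∀ u : ℕ, φ (Ideal.Quotient.mk _ X ^ u) = s u := by
  let ev : (ZMod 2)[X] →ₗ[ZMod 2] ZMod 2 :=
    LinearMap.proj 0 ∘ₗ LinearMap.applyₗ s ∘ₗ (aeval (shiftOp n)).toLinearMap
  have ev_apply (f : (ZMod 2)[X]) : ev f = aeval (shiftOp n) f s 0 := rfl
  have le_ker : (annIdeal s).restrictScalars (ZMod 2) ≤ LinearMap.ker ev := fun f hf => by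
    rw [LinearMap.mem_ker, ev_apply, mem_annIdeal.1 hf, Pi.zero_apply]
  refine ⟨Submodule.liftQ _ ev le_ker ∘ₗ
    (Submodule.Quotient.restrictScalarsEquiv (ZMod 2) (annIdeal s)).symm.toLinearMap, fun u => ?_⟩
  rw [← map_pow]
  change ev (X ^ u) = _
  rw [ev_apply, aeval_X_pow_shiftOp, shift, zero_add]

end Register

namespace IsMaximumLength

variable {m : ℕ} {s : BinSeq (2 ^ m - 1)}

lemma shift_injective (hs : IsMaximumLength m s) : Function.Injective fun u => shift u s := by
  intro u v h
  refine sub_eq_zero.1 (hs.2.2 (u - v) ?_)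
  ext t
  simpa [shift, sub_add_eq_add_sub, add_sub_assoc] using congrFun h (t - v)

/-- The `2 ^ m - 1` shifts of `s` are distinct, and there are at most `2 ^ m` solutions. -/
lemma coe_recurrenceSpace [NeZero (2 ^ m - 1)] (hs : IsMaximumLength m s) {a : Fin m → ZMod 2}
    (hsa : s ∈ recurrenceSpace _ a) :
    (recurrenceSpace (2 ^ m - 1) a : Set _) = insert 0 (Set.range fun u => shift u s) := by
  refine (Set.eq_of_subset_of_ncard_le (Set.insert_subset (zero_mem _) ?_) ?_).symm
  · rintro _ ⟨u, rfl⟩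
    have := aeval_shiftOp_mem_recurrenceSpace hsa (X ^ u.val)
    rwa [aeval_X_pow_shiftOp, ZMod.natCast_zmod_val] at this
  · have not_mem : (0 : BinSeq (2 ^ m - 1)) ∉ Set.range fun u => shift u s := by
      rintro ⟨u, hu⟩
      exact shift_ne_zero hs.1 u hu
    rw [Set.ncard_insert_of_notMem not_mem, ← Set.image_univ,
      Set.ncard_image_of_injective _ hs.shift_injective, Set.ncard_univ, Nat.card_zmod,
      Nat.sub_add_cancel Nat.one_le_two_pow]
    exact natCard_recurrenceSpace_le a

lemma exists_sub_X_pow_mem_annIdeal [NeZero (2 ^ m - 1)] (hs : IsMaximumLength m s)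
    {f : (ZMod 2)[X]} (hf : f ∉ annIdeal s) : ∃ u : ℕ, f - X ^ u ∈ annIdeal s := by
  obtain ⟨a, ha⟩ := hs.2.1
  have hfs := aeval_shiftOp_mem_recurrenceSpace (a := a) ha f
  rw [← SetLike.mem_coe, hs.coe_recurrenceSpace ha] at hfs
  obtain ⟨u, hu⟩ := hfs.resolve_left (mem_annIdeal.not.1 hf)
  refine ⟨u.val, ?_⟩
  rw [mem_annIdeal, map_sub, LinearMap.sub_apply, aeval_X_pow_shiftOp, ZMod.natCast_zmod_val, ← hu,
    sub_self]

lemma isMaximal_annIdeal [NeZero (2 ^ m - 1)] (hs : IsMaximumLength m s) :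
    (annIdeal s).IsMaximal := by
  rw [Ideal.isMaximal_iff]
  refine ⟨fun h => hs.1 ?_, fun J f hJ hf hfJ => ?_⟩
  · rwa [mem_annIdeal, map_one] at h
  · obtain ⟨u, hu⟩ := hs.exists_sub_X_pow_mem_annIdeal hf
    have X_pow_mem : (X ^ u : (ZMod 2)[X]) ∈ J := by
      simpa using J.sub_mem hfJ (hJ hu)
    have period : (X ^ (u * (2 ^ m - 1)) - 1 : (ZMod 2)[X]) ∈ annIdeal s := by
      rw [X_pow_sub_one_mem_annIdeal, Nat.cast_mul, ZMod.natCast_self, mul_zero]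
      ext t
      simp [shift]
    have := J.sub_mem (J.pow_mem_of_mem X_pow_mem _ (NeZero.pos (2 ^ m - 1))) (hJ period)
    rwa [← pow_mul, sub_sub_cancel] at this

lemma isPrimitiveRoot_mk_X (hs : IsMaximumLength m s) :
    IsPrimitiveRoot (Ideal.Quotient.mk (annIdeal s) X) (2 ^ m - 1) := by
  have pow_eq_one (u : ℕ) : Ideal.Quotient.mk (annIdeal s) X ^ u = 1 ↔
      shift (u : ZMod (2 ^ m - 1)) s = s := by
    rw [← X_pow_sub_one_mem_annIdeal, ← map_pow, ← map_one (Ideal.Quotient.mk _),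
      Ideal.Quotient.eq]
  refine ⟨?_, fun u hu => (ZMod.natCast_eq_zero_iff _ _).1 (hs.2.2 _ ((pow_eq_one u).1 hu))⟩
  rw [pow_eq_one, ZMod.natCast_self]
  ext t
  simp [shift]

end IsMaximumLength

lemma natCard_eq_of_forall_eq_pow {L : Type*} [Field L] {n : ℕ} [NeZero n] {γ : L}
    (hγ : IsPrimitiveRoot γ n) (h : ∀ x : L, x ≠ 0 → ∃ u : ℕ, x = γ ^ u) :
    Nat.card L = n + 1 := by
  classical
  have hγ' := hγ.isUnit_unit (NeZero.ne n)
  have card_units : n = Nat.card Lˣ := by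
    rw [hγ'.eq_orderOf]
    refine orderOf_eq_card_of_forall_mem_zpowers fun x => ?_
    obtain ⟨u, hu⟩ := h x x.ne_zero
    exact Subgroup.mem_zpowers_iff.2 ⟨u, Units.ext (by simp [hu])⟩
  have : Finite Lˣ := Nat.finite_of_card_ne_zero (card_units ▸ NeZero.ne n)
  rw [card_units, ← Nat.card_congr WithZero.withZeroUnitsEquiv.toEquiv]
  exact Finite.card_option

lemma exists_trace_mul_eq {K L : Type*} [Field K] [Field L] [Algebra K L] [FiniteDimensional K L]
    [Algebra.IsSeparable K L] (φ : L →ₗ[K] K) : ∃ b, ∀ x, Algebra.trace K L (b * x) = φ x :=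
  ⟨_, fun x => LinearMap.BilinForm.apply_toDual_symm_apply
    (hB := traceForm_nondegenerate K L) (f := φ) (v := x)⟩

theorem IsMaximumLength.exists_field {m : ℕ} (hm : 0 < m) {s : BinSeq (2 ^ m - 1)}
    (hs : IsMaximumLength m s) :
    ∃ (L : Type) (_ : Field L) (_ : Finite L) (_ : Algebra (ZMod 2) L) (γ b : L),
      Nat.card L = 2 ^ m ∧ IsPrimitiveRoot γ (2 ^ m - 1) ∧ b ≠ 0 ∧
      ∀ t : ℕ, s (t : ZMod (2 ^ m - 1)) = Algebra.trace (ZMod 2) L (b * γ ^ t) := by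
  have : NeZero (2 ^ m - 1) := ⟨by have := Nat.one_lt_two_pow hm.ne'; lia⟩
  have := hs.isMaximal_annIdeal
  let : Field ((ZMod 2)[X] ⧸ annIdeal s) := Ideal.Quotient.field _
  have card_eq : Nat.card ((ZMod 2)[X] ⧸ annIdeal s) = 2 ^ m := by
    rw [natCard_eq_of_forall_eq_pow hs.isPrimitiveRoot_mk_X, Nat.sub_add_cancel Nat.one_le_two_pow]
    intro x hx
    obtain ⟨f, rfl⟩ := Ideal.Quotient.mk_surjective x
    obtain ⟨u, hu⟩ := hs.exists_sub_X_pow_mem_annIdeal fun hf =>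
      hx (Ideal.Quotient.eq_zero_iff_mem.2 hf)
    exact ⟨u, by rw [← map_pow]; exact Ideal.Quotient.eq.2 hu⟩
  have : Finite ((ZMod 2)[X] ⧸ annIdeal s) := Nat.finite_of_card_ne_zero (by simp [card_eq])
  obtain ⟨φ, hφ⟩ := exists_functional_quotient_annIdeal s
  obtain ⟨b, hb⟩ := exists_trace_mul_eq φ
  refine ⟨_, inferInstance, inferInstance, inferInstance, Ideal.Quotient.mk _ X, b, card_eq,
    hs.isPrimitiveRoot_mk_X, ?_, fun t => by rw [hb, hφ]⟩
  rintro rfl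
  refine hs.1 (funext fun t => ?_)
  rw [← ZMod.natCast_zmod_val t, ← hφ, ← hb, zero_mul, map_zero, Pi.zero_apply]

/-! ### The Gold systems of the three families -/

section CyclicGroup

variable {G : Type*} [Group G] {τ : G}

lemma inv_pow_eq_pow_of_add_eq_orderOf {a b : ℕ} (h : a + b = orderOf τ) :
    (τ ^ a)⁻¹ = τ ^ b :=
  inv_eq_of_mul_eq_one_right (by rw [← pow_add, h, pow_orderOf_eq_one])

lemma symmRange_inv {ι : Type*} (ρ : ι → G) : symmRange (fun j => (ρ j)⁻¹) = symmRange ρ := by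
  ext g
  simp only [symmRange, Set.mem_ofPred_eq, inv_inv, or_comm]

lemma symmRange_pow_succ_subset_arc (τ : G) (κ : ℕ) :
    symmRange (fun j : Fin κ => τ ^ ((j : ℕ) + 1)) ⊆ arc (τ ^ κ)⁻¹ τ (2 * κ) := by
  rintro g ⟨j, rfl | rfl⟩
  · exact ⟨κ + j + 1, by lia, by rw [add_assoc, pow_add τ κ, inv_mul_cancel_left]⟩
  · refine ⟨κ - (j + 1), by lia, ?_⟩
    rw [eq_inv_mul_iff_mul_eq, mul_inv_eq_iff_eq_mul, ← pow_add, Nat.sub_add_cancel j.2]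

lemma symmRange_pow_sub_subset_arc {h κ : ℕ} (hκ : κ ≤ h) (hord : orderOf τ = 2 * h + 1) :
    symmRange (fun j : Fin κ => τ ^ (h - (j : ℕ))) ⊆ arc (τ ^ (h - κ + 1)) τ (2 * κ) := by
  rintro g ⟨j, rfl | rfl⟩
  · refine ⟨κ - 1 - j, by lia, ?_⟩
    simp only [← pow_add]
    congr 1
    lia
  · refine ⟨κ + j, by lia, ?_⟩
    rw [inv_pow_eq_pow_of_add_eq_orderOf (b := h + 1 + j) (by lia), ← pow_add]
    congr 1
    lia

variable [Finite G]

lemma exists_pow_of_mem_compl_insert_one_symmRange {ι : Type*} {p : ι → ℕ}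
    (hτ : ∀ g, g ∈ Subgroup.zpowers τ) {g : G}
    (hg : g ∈ (insert 1 (symmRange fun j => τ ^ p j))ᶜ) :
    ∃ t < orderOf τ, t ≠ 0 ∧ (∀ j, t ≠ p j ∧ t + p j ≠ orderOf τ) ∧ g = τ ^ t := by
  classical
  obtain ⟨t, ht, rfl⟩ := mem_image.1 (mem_zpowers_iff_mem_range_orderOf.1 (hτ g))
  simp only [Set.mem_compl_iff, Set.mem_insert_iff, not_or] at hg
  refine ⟨t, mem_range.1 ht, fun h => hg.1 (by rw [h, pow_zero]), fun j => ⟨?_, ?_⟩, rfl⟩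
  · exact fun h => hg.2 ⟨j, Or.inl (by rw [h])⟩
  · exact fun h => hg.2 ⟨j, Or.inr (inv_pow_eq_pow_of_add_eq_orderOf (by lia)).symm⟩

lemma compl_insert_one_symmRange_pow_succ_subset_arc (hτ : ∀ g, g ∈ Subgroup.zpowers τ)
    {κ : ℕ} :
    (insert 1 (symmRange fun j : Fin κ => τ ^ ((j : ℕ) + 1)))ᶜ ⊆
      arc (τ ^ (κ + 1)) τ (orderOf τ - 2 * κ - 1) := by
  intro g hg
  obtain ⟨t, ht, ht0, hj, rfl⟩ := exists_pow_of_mem_compl_insert_one_symmRange hτ hg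
  have lt_t : κ < t := by
    by_contra! hle
    exact (hj ⟨t - 1, by lia⟩).1 (by simp only; lia)
  have t_lt : t + κ < orderOf τ := by
    by_contra! hle
    exact (hj ⟨orderOf τ - t - 1, by lia⟩).2 (by simp only; lia)
  exact ⟨t - (κ + 1), by lia, by rw [← pow_add, Nat.add_sub_cancel' lt_t]⟩

lemma compl_insert_one_symmRange_pow_sub_subset_arc (hτ : ∀ g, g ∈ Subgroup.zpowers τ) {h κ : ℕ}
    (hκ : κ ≤ h) (hord : orderOf τ = 2 * h + 1) :
    (insert 1 (symmRange fun j : Fin κ => τ ^ (h - (j : ℕ))))ᶜ ⊆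
      arc (τ ^ (h - κ))⁻¹ τ (orderOf τ - 2 * κ - 1) := by
  intro g hg
  obtain ⟨t, ht, ht0, hj, rfl⟩ := exists_pow_of_mem_compl_insert_one_symmRange hτ hg
  have t_le_or_le_t : t ≤ h - κ ∨ h + κ + 1 ≤ t := by
    by_contra! hlt
    rcases le_or_gt t h with hth | hth
    · exact (hj ⟨h - t, by lia⟩).1 (by simp only; lia)
    · exact (hj ⟨t - h - 1, by lia⟩).2 (by simp only; lia)
  rcases t_le_or_le_t with ht' | ht'
  · exact ⟨h - κ + t, by lia, by rw [pow_add, inv_mul_cancel_left]⟩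
  · refine ⟨t - (h + κ + 1), by lia, ?_⟩
    rw [inv_pow_eq_pow_of_add_eq_orderOf (b := h + κ + 1) (by lia), ← pow_add,
      Nat.add_sub_cancel' ht']

end CyclicGroup

section GoldSystems

variable {K L ι : Type*} [Field K] [Field L] [Algebra K L] [FiniteDimensional K L] [Fintype ι]

lemma IsGoldSystem.inv {ρ : ι → L ≃ₐ[K] L} (hρ : IsGoldSystem ρ) :
    IsGoldSystem fun j => (ρ j)⁻¹ where
  injective := inv_injective.comp hρ.injective
  ne_inv i j h := hρ.ne_inv j i (by rw [h, inv_inv])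
  two_mul_card_lt := hρ.two_mul_card_lt
  thin := by rw [symmRange_inv]; exact hρ.thin
  cothin := by rw [symmRange_inv]; exact hρ.cothin

variable [IsGalois K L] {τ : L ≃ₐ[K] L}

lemma mem_range_algebraMap_of_apply_eq_self (hτ : ∀ g, g ∈ Subgroup.zpowers τ) {x : L}
    (hx : τ x = x) : x ∈ (algebraMap K L).range := by
  refine (IsGalois.mem_range_algebraMap_iff_fixed x).2 fun g => ?_
  exact Subgroup.zpowers_le.2 (show τ ∈ MulAction.stabilizer (L ≃ₐ[K] L) x from hx) (hτ g)

lemma isGoldSystem_of_subset_arc (hτ : ∀ g, g ∈ Subgroup.zpowers τ) {h : ℕ}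
    (hord : orderOf τ = 2 * h + 1) (hn : finrank K L = 2 * h + 1) {p : ι → ℕ}
    (hp : ∀ j, p j ∈ Set.Icc 1 h) (hinj : p.Injective) (hcard : Fintype.card ι ≤ h)
    {β β' : L ≃ₐ[K] L} (thin : symmRange (fun j => τ ^ p j) ⊆ arc β τ (2 * Fintype.card ι))
    (cothin : (insert 1 (symmRange fun j => τ ^ p j))ᶜ ⊆
      arc β' τ (orderOf τ - 2 * Fintype.card ι - 1)) :
    IsGoldSystem fun j => τ ^ p j where
  injective i j hij := hinj <| pow_injOn_Iio_orderOf (by have := (hp i).2; grind)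
    (by have := (hp j).2; grind) hij
  ne_inv i j hij := by
    have := Nat.le_of_dvd (by grind) (orderOf_dvd_of_pow_eq_one (n := p i + p j) (x := τ)
      (by rw [pow_add, hij, inv_mul_cancel]))
    have := (hp i).2
    have := (hp j).2
    lia
  two_mul_card_lt := by lia
  thin := (hasKernelBound_arc (fun _ => mem_range_algebraMap_of_apply_eq_self hτ) β
    (by lia)).mono thin
  cothin := (hasKernelBound_arc (fun _ => mem_range_algebraMap_of_apply_eq_self hτ) β'
    (by lia)).mono (by rwa [hn, ← hord])

lemma isGoldSystem_pow_succ (hτ : ∀ g, g ∈ Subgroup.zpowers τ) {h κ : ℕ}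
    (hord : orderOf τ = 2 * h + 1) (hn : finrank K L = 2 * h + 1) (hκ : κ ≤ h) :
    IsGoldSystem fun j : Fin κ => τ ^ ((j : ℕ) + 1) :=
  isGoldSystem_of_subset_arc hτ hord hn (fun j => ⟨by lia, by lia⟩)
    ((add_left_injective 1).comp Fin.val_injective) (by simpa using hκ)
    (by simpa using symmRange_pow_succ_subset_arc τ κ)
    (by simpa using compl_insert_one_symmRange_pow_succ_subset_arc hτ)

lemma isGoldSystem_pow_sub (hτ : ∀ g, g ∈ Subgroup.zpowers τ) {h κ : ℕ}
    (hord : orderOf τ = 2 * h + 1) (hn : finrank K L = 2 * h + 1) (hκ : κ ≤ h) :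
    IsGoldSystem fun j : Fin κ => τ ^ (h - (j : ℕ)) :=
  isGoldSystem_of_subset_arc hτ hord hn (fun j => ⟨by lia, by lia⟩)
    (fun i j (hij : h - (i : ℕ) = h - j) => Fin.ext (by lia)) (by simpa using hκ)
    (by simpa using symmRange_pow_sub_subset_arc hκ hord)
    (by simpa using compl_insert_one_symmRange_pow_sub_subset_arc hτ hκ hord)

end GoldSystems

lemma exists_generator_over_fixedField {F L : Type*} [Field F] [Field L] [Algebra F L]
    [FiniteDimensional F L] (σ : L ≃ₐ[F] L) :
    ∃ (K : IntermediateField F L) (τ : L ≃ₐ[K] L), (∀ x, τ x = σ x) ∧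
      (∀ g, g ∈ Subgroup.zpowers τ) ∧ orderOf τ = orderOf σ ∧ finrank K L = orderOf σ := by
  let φ := IntermediateField.subgroupEquivAlgEquiv (Subgroup.zpowers σ)
  let generator : Subgroup.zpowers σ := ⟨σ, Subgroup.mem_zpowers σ⟩
  refine ⟨IntermediateField.fixedField (Subgroup.zpowers σ), φ generator, fun x => rfl,
    fun g => ?_, ?_, ?_⟩
  · obtain ⟨x, rfl⟩ := φ.surjective g
    obtain ⟨z, hz⟩ := Subgroup.mem_zpowers_iff.1 x.2
    exact Subgroup.mem_zpowers_iff.2 ⟨z, by rw [← map_zpow]; exact congrArg φ (Subtype.ext hz)⟩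
  · rw [MulEquiv.orderOf_eq]
    exact Subgroup.orderOf_mk σ _
  · rw [IntermediateField.finrank_fixedField_eq_card, Nat.card_zpowers]

section Frobenius

variable {L : Type*} [Field L] [Finite L] [Algebra (ZMod 2) L]

lemma pow_two_pow_finrank_mul_add (c b : ℕ) (x : L) :
    x ^ 2 ^ (finrank (ZMod 2) L * c + b) = x ^ 2 ^ b := by
  have card_eq : Nat.card L = 2 ^ finrank (ZMod 2) L := by
    rw [Module.natCard_eq_pow_finrank (K := ZMod 2), Nat.card_zmod]
  have := Fintype.ofFinite L
  rw [pow_add, pow_mul, pow_mul, ← card_eq, Nat.card_eq_fintype_card, FiniteField.pow_card_pow]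

lemma exists_frobenius_pow_generator (D : ℕ) :
    ∃ (K : IntermediateField (ZMod 2) L) (τ : L ≃ₐ[K] L),
      (∀ c x, (τ ^ c) x = x ^ 2 ^ (D * c)) ∧ (∀ g, g ∈ Subgroup.zpowers τ) ∧
      orderOf τ = finrank (ZMod 2) L / (finrank (ZMod 2) L).gcd D ∧
      finrank K L = finrank (ZMod 2) L / (finrank (ZMod 2) L).gcd D := by
  let frob := FiniteField.frobeniusAlgEquivOfAlgebraic (ZMod 2) L
  have frob_pow_apply (c : ℕ) (x : L) : (frob ^ c) x = x ^ 2 ^ c := by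
    rw [AlgEquiv.coe_pow, FiniteField.coe_frobeniusAlgEquivOfAlgebraic_iterate, ZMod.card]
  have orderOf_eq : orderOf (frob ^ D) = finrank (ZMod 2) L / (finrank (ZMod 2) L).gcd D := by
    rw [orderOf_pow, FiniteField.orderOf_frobeniusAlgEquivOfAlgebraic]
  obtain ⟨K, τ, τ_apply, generates, hord, hn⟩ := exists_generator_over_fixedField (frob ^ D)
  refine ⟨K, τ, fun c x => ?_, generates, hord.trans orderOf_eq, hn.trans orderOf_eq⟩
  rw [← frob_pow_apply, pow_mul]
  induction c with
  | zero => rfl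
  | succ c ih => rw [pow_succ', pow_succ', AlgEquiv.mul_apply, AlgEquiv.mul_apply, ih, τ_apply]

/-- For the odd family, `(2 * j + 1) * d` is `-(h - j) * (2 * d)` modulo `(2 * h + 1) * d`: it is
the inverse of the descending system attached to `2 * d`. -/
theorem Family.exists_isGoldSystem (F : Family) {m d e h κ : ℕ} (hL : finrank (ZMod 2) L = m)
    (he0 : 0 < e) (he : e = m.gcd d) (he' : e = m.gcd (2 * d)) (hm : m = e * (2 * h + 1))
    (hκ : κ ≤ h) :
    ∃ (K : IntermediateField (ZMod 2) L) (ρ : Fin κ → L ≃ₐ[K] L), IsGoldSystem ρ ∧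
      finrank K L = 2 * h + 1 ∧ ∀ j x, ρ j x = x ^ 2 ^ (F.multiplier m e (j + 1) * d) := by
  have degree_eq : m / e = 2 * h + 1 := by rw [hm, Nat.mul_div_cancel_left _ he0]
  have generator (D : ℕ) (hD : e = m.gcd D) := by
    simpa only [hL, ← hD, degree_eq] using exists_frobenius_pow_generator (L := L) D
  cases F with
  | consecutive =>
    obtain ⟨K, τ, pow_apply, generates, hord, hn⟩ := generator d he
    refine ⟨K, _, isGoldSystem_pow_succ generates hord hn hκ, hn, fun j x => ?_⟩
    rw [pow_apply, Family.multiplier, mul_comm]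
  | descending =>
    obtain ⟨K, τ, pow_apply, generates, hord, hn⟩ := generator d he
    refine ⟨K, _, isGoldSystem_pow_sub generates hord hn hκ, hn, fun j x => ?_⟩
    have : (m + e) / (2 * e) = h + 1 :=
      Nat.div_eq_of_eq_mul_left (by lia) (by rw [hm]; ring)
    rw [pow_apply, Family.multiplier, this, mul_comm, Nat.add_sub_add_right]
  | odd =>
    obtain ⟨K, τ, pow_apply, generates, hord, hn⟩ := generator (2 * d) he'
    refine ⟨K, _, (isGoldSystem_pow_sub generates hord hn hκ).inv, hn, fun j x => ?_⟩
    obtain ⟨c, hc⟩ : e ∣ d := he ▸ Nat.gcd_dvd_right m d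
    have exponent : 2 * d * (h + 1 + j) = finrank (ZMod 2) L * c + (2 * j + 1) * d := by
      rw [hL, hm, hc]
      ring
    rw [inv_pow_eq_pow_of_add_eq_orderOf (b := h + 1 + j) (by lia), pow_apply, Family.multiplier,
      exponent, pow_two_pow_finrank_mul_add]
    rfl

end Frobenius

/-! ### The exponential sums of the code -/

section GoldForm

variable {K L ι : Type*} [Field K] [Field L] [Algebra K L] [Algebra (ZMod 2) L] [Fintype ι]

/-- The quadratic form `x ↦ Tr(∑_j a_j x ρ_j(x))` over `𝔽₂`. -/
noncomputable def goldForm (ρ : ι → L ≃ₐ[K] L) (a : ι → L) (x : L) : ZMod 2 :=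
  Algebra.trace (ZMod 2) L (∑ j, a j * (x * ρ j x))

/-- The exponential sum `∑_x (-1) ^ Tr(∑_j a_j x ρ_j(x) + b x)` of a pair `p = (b, a)`. -/
noncomputable def goldSum [Fintype L] (ρ : ι → L ≃ₐ[K] L) (p : L × (ι → L)) : ℤ :=
  walsh (traceSign L) (fun x => sign (goldForm ρ p.2 x)) p.1

lemma goldForm_apply_zero (ρ : ι → L ≃ₐ[K] L) (a : ι → L) : goldForm ρ a 0 = 0 := by
  simp [goldForm]

lemma goldForm_zero (ρ : ι → L ≃ₐ[K] L) (x : L) : goldForm ρ 0 x = 0 := by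
  simp [goldForm]

variable [Finite L] [Algebra (ZMod 2) K] [IsScalarTower (ZMod 2) K L]

lemma goldForm_add (ρ : ι → L ≃ₐ[K] L) (a : ι → L) (x y : L) :
    goldForm ρ a (x + y) = goldForm ρ a x + goldForm ρ a y +
      Algebra.trace (ZMod 2) L (polarOp ρ a x * y) := by
  have := charP_of_injective_algebraMap (algebraMap (ZMod 2) L).injective 2
  have := Finite.of_injective _ (algebraMap K L).injective
  rw [← Algebra.trace_trace (S := K) (polarOp ρ a x * y), trace_polarOp_mul, ← map_sum,
    Algebra.trace_trace]
  simp only [goldForm, ← map_add, ← sum_add_distrib, CharTwo.sub_eq_add]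
  congr 1
  refine sum_congr rfl fun j _ => ?_
  rw [map_add (ρ j)]
  ring

lemma isQuadraticPhase_goldForm (ρ : ι → L ≃ₐ[K] L) (a : ι → L) :
    IsQuadraticPhase (traceSign L) (fun x => sign (goldForm ρ a x)) (polarOp ρ a) where
  mul_self x := sign_mul_self _
  map_add x y := by
    rw [goldForm_add, AddChar.map_add_eq_mul, AddChar.map_add_eq_mul, traceSign_apply]

end GoldForm

section Counting

variable {K L ι : Type*} [Field K] [Field L] [Algebra K L] [Fintype L] [Fintype ι]
variable [Algebra (ZMod 2) K] [Algebra (ZMod 2) L] [IsScalarTower (ZMod 2) K L]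
variable {h i : ℕ} {ε : ℤ}

lemma two_mul_card_goldSum_fiber (hn : finrank K L = 2 * h + 1) (hi : i ≤ h) (hε : ε * ε = 1)
    (ρ : ι → L ≃ₐ[K] L) (a : ι → L) :
    2 * (Nat.card {b : L // goldSum ρ (b, a) = ε * (Nat.card K : ℤ) ^ (h + 1 + i)} : ℤ) =
      if finrank K (LinearMap.ker (polarOp ρ a)) = 2 * i + 1 then
        ((Nat.card K : ℤ) ^ (h - i)) ^ 2 + ε * (Nat.card K : ℤ) ^ (h - i) else 0 := by
  have := charP_of_injective_algebraMap (algebraMap (ZMod 2) L).injective 2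
  have := Finite.of_injective _ (algebraMap K L).injective
  have phase := isQuadraticPhase_goldForm ρ a
  have one_lt_card : 1 < Nat.card K := Finite.one_lt_card
  have ne_zero : (Nat.card K : ℤ) ^ (h + 1 + i) ≠ 0 := pow_ne_zero _ (by lia)
  have card_eq : (Fintype.card L : ℤ) = (Nat.card K : ℤ) ^ (2 * h + 1) := by
    rw [← hn, ← Nat.card_eq_fintype_card, Module.natCard_eq_pow_finrank (K := K) (V := L),
      Nat.cast_pow]
  have radical_eq_iff : (Fintype.card L : ℤ) * Nat.card (LinearMap.ker (polarOp ρ a)) =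
      ((Nat.card K : ℤ) ^ (h + 1 + i)) ^ 2 ↔
        finrank K (LinearMap.ker (polarOp ρ a)) = 2 * i + 1 := by
    rw [card_eq, Module.natCard_eq_pow_finrank (K := K) (V := LinearMap.ker _), Nat.cast_pow,
      ← pow_add, ← pow_mul, pow_right_inj₀ (by lia) (by lia)]
    lia
  split_ifs with radical
  · refine phase.two_mul_card_walsh_eq (traceSign_isPrimitive L) ne_zero ?_
      (radical_eq_iff.2 radical) hε
    rw [card_eq, ← pow_add]
    congr 1
    lia
  · have : IsEmpty {b : L // goldSum ρ (b, a) = ε * (Nat.card K : ℤ) ^ (h + 1 + i)} :=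
      ⟨fun b => radical <| radical_eq_iff.1 <|
        phase.card_mul_card_ker_eq_of_walsh_eq (traceSign_isPrimitive L) ne_zero hε b.2⟩
    simp

lemma two_mul_card_goldSum (hn : finrank K L = 2 * h + 1) (hi : i ≤ h) (hε : ε * ε = 1)
    (ρ : ι → L ≃ₐ[K] L) :
    2 * (Nat.card {p // goldSum ρ p = ε * (Nat.card K : ℤ) ^ (h + 1 + i)} : ℤ) =
      (((Nat.card K : ℤ) ^ (h - i)) ^ 2 + ε * (Nat.card K : ℤ) ^ (h - i)) *
        Nat.card {a : ι → L // finrank K (LinearMap.ker (polarOp ρ a)) = 2 * i + 1} := by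
  classical
  have fibers : Nat.card {p // goldSum ρ p = ε * (Nat.card K : ℤ) ^ (h + 1 + i)} =
      ∑ a : ι → L, Nat.card {b : L // goldSum ρ (b, a) = ε * (Nat.card K : ℤ) ^ (h + 1 + i)} := by
    rw [← Nat.card_sigma]
    exact Nat.card_congr
      { toFun p := ⟨p.1.2, p.1.1, p.2⟩
        invFun p := ⟨(p.2.1, p.1), p.2.2⟩ }
  rw [fibers, Nat.cast_sum, mul_sum, sum_congr rfl fun a _ =>
    two_mul_card_goldSum_fiber hn hi hε ρ a, ← sum_filter, sum_const, nsmul_eq_mul, mul_comm,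
    Nat.card_eq_fintype_card (α := {a : ι → L // _}), Fintype.card_subtype]

end Counting

/-! ### Parametrisation of the code -/

section PrimitiveElement

variable {L : Type*} [Field L] {n : ℕ} {γ : L}

lemma exists_pow_eq_of_ne_zero [Finite L] [NeZero n] (hL : Nat.card L = n + 1)
    (hγ : IsPrimitiveRoot γ n) {x : L} (hx : x ≠ 0) : ∃ u < n, γ ^ u = x := by
  have := Fintype.ofFinite L
  refine hγ.eq_pow_of_pow_eq_one ?_
  rw [← FiniteField.pow_card_sub_one_eq_one x hx, ← Nat.card_eq_fintype_card, hL,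
    Nat.add_sub_cancel]

lemma pow_val_natCast (hγ : IsPrimitiveRoot γ n) (t : ℕ) : γ ^ (t : ZMod n).val = γ ^ t := by
  rw [ZMod.val_natCast, ← pow_eq_pow_mod t hγ.pow_eq_one]

lemma sum_range_pow [Fintype L] [NeZero n] (hL : Nat.card L = n + 1) (hγ : IsPrimitiveRoot γ n)
    {A : Type*} [AddCommGroup A] (G : L → A) :
    ∑ t ∈ range n, G (γ ^ t) = ∑ x, G x - G 0 := by
  classical
  rw [← sum_erase_eq_sub (mem_univ 0)]
  refine sum_nbij (γ ^ ·) (fun t _ => ?_) (fun t ht u hu => ?_) (fun x hx => ?_) fun _ _ => rfl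
  · exact mem_erase.2 ⟨pow_ne_zero _ (hγ.ne_zero (NeZero.ne n)), mem_univ _⟩
  · exact hγ.pow_inj (mem_range.1 ht) (mem_range.1 hu)
  · obtain ⟨u, hu, rfl⟩ := exists_pow_eq_of_ne_zero hL hγ (ne_of_mem_erase hx)
    exact ⟨u, mem_coe.2 (mem_range.2 hu), rfl⟩

end PrimitiveElement

section Words

variable {K L ι : Type*} [Field K] [Field L] [Algebra K L] [Algebra (ZMod 2) L] [Fintype ι]

/-- The sequence `t ↦ Tr(∑_j a_j γ ^ t ρ_j(γ ^ t) + b γ ^ t)` of a pair `(b, a)`, for an `n`-th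
root of unity `γ`. -/
noncomputable def word (n : ℕ) (ρ : ι → L ≃ₐ[K] L) (γ : L) :
    L × (ι → L) →ₗ[ZMod 2] BinSeq n where
  toFun p t := goldForm ρ p.2 (γ ^ t.val) + Algebra.trace (ZMod 2) L (p.1 * γ ^ t.val)
  map_add' p p' := by
    ext t
    simp only [goldForm, Pi.add_apply, Prod.fst_add, Prod.snd_add, add_mul, map_add,
      sum_add_distrib]
    ring
  map_smul' c p := by
    ext t
    simp only [goldForm, Pi.smul_apply, Prod.smul_fst, Prod.smul_snd, smul_mul_assoc,
      ← smul_sum, map_smul, RingHom.id_apply, smul_add]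

variable {n : ℕ} {ρ : ι → L ≃ₐ[K] L} {γ : L}

lemma word_apply (p : L × (ι → L)) (t : ZMod n) :
    word n ρ γ p t =
      goldForm ρ p.2 (γ ^ t.val) + Algebra.trace (ZMod 2) L (p.1 * γ ^ t.val) := rfl

lemma range_word_le {S : Submodule (ZMod 2) (BinSeq n)} [DecidableEq ι]
    (linear : ∀ b, word n ρ γ (b, 0) ∈ S)
    (quadratic : ∀ j c, word n ρ γ (0, Pi.single j c) ∈ S) : LinearMap.range (word n ρ γ) ≤ S := by
  rintro _ ⟨⟨b, a⟩, rfl⟩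
  have decomposition : (b, a) = (b, (0 : ι → L)) + ∑ j, ((0 : L), Pi.single j (a j)) := by
    ext x
    · simp [Prod.fst_sum]
    · simp [Prod.snd_sum, univ_sum_single]
  rw [decomposition, map_add, map_sum]
  exact S.add_mem (linear b) (S.sum_mem fun j _ => quadratic j (a j))

variable [NeZero n]

lemma DC_word [Fintype L] (hL : Nat.card L = n + 1) (hγ : IsPrimitiveRoot γ n)
    (p : L × (ι → L)) : DC (word n ρ γ p) = -1 + goldSum ρ p := by
  have sum_eq := sum_range_pow hL hγ fun x => sign (goldForm ρ p.2 x) * traceSign L (p.1 * x)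
  rw [goldForm_apply_zero, mul_zero, AddChar.map_zero_eq_one, AddChar.map_zero_eq_one,
    mul_one] at sum_eq
  rw [goldSum, walsh, ← sub_eq_neg_add, ← sum_eq, DC]
  refine sum_congr rfl fun t _ => ?_
  rw [word_apply, pow_val_natCast hγ, ← sign_apply, AddChar.map_add_eq_mul, traceSign_apply]

theorem word_injective [Finite L] [FiniteDimensional K L] [Algebra (ZMod 2) K]
    [IsScalarTower (ZMod 2) K L] (hρ : IsGoldSystem ρ) (hL : Nat.card L = n + 1)
    (hγ : IsPrimitiveRoot γ n) : Function.Injective (word n ρ γ) := by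
  rw [injective_iff_map_eq_zero]
  rintro ⟨b, a⟩ word_eq_zero
  have vanish (x : L) : goldForm ρ a x + Algebra.trace (ZMod 2) L (b * x) = 0 := by
    by_cases hx : x = 0
    · rw [hx, goldForm_apply_zero, mul_zero, map_zero, add_zero]
    · obtain ⟨u, -, rfl⟩ := exists_pow_eq_of_ne_zero hL hγ hx
      simpa only [word_apply, pow_val_natCast hγ, Pi.zero_apply] using
        congrFun word_eq_zero (u : ZMod n)
  have polar_eq_zero (x : L) : polarOp ρ a x = 0 := by
    refine (traceForm_nondegenerate (ZMod 2) L).1 _ fun y => ?_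
    have vanish_add := vanish (x + y)
    rw [goldForm_add, mul_add, map_add] at vanish_add
    rw [Algebra.traceForm_apply]
    linear_combination vanish_add - vanish x - vanish y
  obtain rfl : a = 0 := by
    by_contra ha
    have ker_eq_top : LinearMap.ker (polarOp ρ a) = ⊤ := LinearMap.ker_eq_top.2
      (LinearMap.ext polar_eq_zero)
    have := hρ.finrank_ker_polarOp_le ha
    have := hρ.two_mul_card_lt
    rw [ker_eq_top, finrank_top] at *
    lia
  obtain rfl : b = 0 := by
    refine (traceForm_nondegenerate (ZMod 2) L).1 _ fun x => ?_
    simpa only [goldForm_zero, zero_add, Algebra.traceForm_apply] using vanish x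
  rfl

end Words

section Code

variable {K L ι : Type*} [Field K] [Field L] [Algebra K L]

lemma eq_one_of_mul_apply_eq_one [CharP L 2] {g : L ≃ₐ[K] L} (hg : Odd (orderOf g)) {z : L}
    (hz : z * g z = 1) : z = 1 := by
  have apply_eq_inv : g z = z⁻¹ := eq_inv_of_mul_eq_one_right hz
  have period_two : Function.IsPeriodicPt g 2 z := by
    change g (g z) = z
    rw [apply_eq_inv, map_inv₀, apply_eq_inv, inv_inv]
  have period_order : Function.IsPeriodicPt g (orderOf g) z := by
    rw [Function.IsPeriodicPt, Function.IsFixedPt, ← AlgEquiv.coe_pow, pow_orderOf_eq_one,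
      AlgEquiv.one_apply]
  have fixed : g z = z := by
    have := period_two.gcd period_order
    rwa [(Nat.coprime_two_left.2 hg).gcd_eq_one] at this
  rw [fixed] at hz
  exact CharTwo.add_eq_zero.1 (mul_self_eq_zero.1 (by
    rw [CharTwo.add_mul_self, hz, one_mul, CharTwo.add_self_eq_zero]))

lemma mul_apply_injective [CharP L 2] {g : L ≃ₐ[K] L} (hg : Odd (orderOf g)) :
    Function.Injective fun x : L => x * g x := by
  intro x y (hxy : x * g x = y * g y)
  rcases eq_or_ne y 0 with rfl | hy
  · rw [zero_mul, mul_eq_zero, map_eq_zero_iff _ g.injective, or_self] at hxy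
    exact hxy
  · have hgy : g y ≠ 0 := (map_ne_zero_iff _ g.injective).2 hy
    refine (div_eq_one_iff_eq hy).1 (eq_one_of_mul_apply_eq_one hg ?_)
    rw [map_div₀, div_mul_div_comm, hxy, div_self (mul_ne_zero hy hgy)]

variable [Algebra (ZMod 2) L] [Fintype ι] {n : ℕ} [NeZero n] {ρ : ι → L ≃ₐ[K] L} {γ b : L}
variable {s : BinSeq n}

lemma shift_eq_word (hs : ∀ t : ℕ, s (t : ZMod n) = Algebra.trace (ZMod 2) L (b * γ ^ t))
    (ρ : ι → L ≃ₐ[K] L) (u : ℕ) :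
    shift (u : ZMod n) s = word n ρ γ (b * γ ^ u, 0) := by
  ext t
  rw [word_apply, goldForm_zero, zero_add, shift]
  conv_lhs => rw [← ZMod.natCast_zmod_val t, ← Nat.cast_add, hs]
  ring_nf

lemma shift_decimate_eq_word [DecidableEq ι]
    (hs : ∀ t : ℕ, s (t : ZMod n) = Algebra.trace (ZMod 2) L (b * γ ^ t)) {j : ι} {f : ℕ}
    (hf : ∀ x, x * ρ j x = x ^ f) (u : ℕ) :
    shift (u : ZMod n) (decimate f s) = word n ρ γ (0, Pi.single j (b * γ ^ (f * u))) := by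
  ext t
  rw [word_apply, zero_mul, map_zero, add_zero, goldForm,
    sum_eq_single j (fun i _ hi => by simp [hi]) (by simp), hf, shift, decimate]
  simp only [Pi.single_eq_same]
  conv_lhs => rw [← ZMod.natCast_zmod_val t, ← Nat.cast_add, ← Nat.cast_mul, hs]
  ring_nf

theorem span_shift_eq_range_word [Finite L] (hL : Nat.card L = n + 1) (hγ : IsPrimitiveRoot γ n)
    (hb : b ≠ 0) (hs : ∀ t : ℕ, s (t : ZMod n) = Algebra.trace (ZMod 2) L (b * γ ^ t))
    (hodd : ∀ j, Odd (orderOf (ρ j))) {f : ι → ℕ} (hf : ∀ j x, x * ρ j x = x ^ f j) :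
    Submodule.span (ZMod 2) {c | ∃ u, c = shift u s ∨ ∃ j, c = shift u (decimate (f j) s)} =
      LinearMap.range (word n ρ γ) := by
  classical
  have := charP_of_injective_algebraMap (algebraMap (ZMod 2) L).injective 2
  refine le_antisymm (Submodule.span_le.2 ?_) (range_word_le (fun c => ?_) fun j c => ?_)
  · rintro c ⟨u, hu⟩
    rw [← ZMod.natCast_zmod_val u] at hu
    rcases hu with rfl | ⟨j, rfl⟩
    · exact ⟨_, (shift_eq_word hs ρ _).symm⟩
    · exact ⟨_, (shift_decimate_eq_word hs (hf j) _).symm⟩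
  · rcases eq_or_ne c 0 with rfl | hc
    · rw [Prod.mk_zero_zero, map_zero]
      exact Submodule.zero_mem _
    · obtain ⟨u, -, hu⟩ := exists_pow_eq_of_ne_zero hL hγ (div_ne_zero hc hb)
      rw [show c = b * γ ^ u by rw [hu, mul_div_cancel₀ _ hb], ← shift_eq_word hs]
      exact Submodule.subset_span ⟨_, Or.inl rfl⟩
  · rcases eq_or_ne c 0 with rfl | hc
    · rw [Pi.single_zero, Prod.mk_zero_zero, map_zero]
      exact Submodule.zero_mem _
    · obtain ⟨y, hy : y * ρ j y = c / b⟩ :=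
        Finite.surjective_of_injective (mul_apply_injective (hodd j)) (c / b)
      have hy0 : y ≠ 0 := by
        rintro rfl
        rw [zero_mul] at hy
        exact div_ne_zero hc hb hy.symm
      obtain ⟨u, -, rfl⟩ := exists_pow_eq_of_ne_zero hL hγ hy0
      have c_eq : c = b * γ ^ (f j * u) := by
        rw [mul_comm (f j), pow_mul, ← hf, hy, mul_div_cancel₀ _ hb]
      rw [c_eq, ← shift_decimate_eq_word hs (hf j)]
      exact Submodule.subset_span ⟨_, Or.inr ⟨j, rfl⟩⟩

lemma code_eq_span_fin (F : Family) (m d e k : ℕ) (s : BinSeq (2 ^ m - 1)) :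
    code F m d e k s = Submodule.span (ZMod 2) {c | ∃ u, c = shift u s ∨
      ∃ j : Fin (k - 1), c = shift u (decimate (F.factor m d e (j + 1)) s)} := by
  rw [code]
  congr! 6 with c u
  constructor
  · rintro ⟨j, hj, rfl⟩
    obtain ⟨one_le, le⟩ := mem_Icc.1 hj
    exact ⟨⟨j - 1, by lia⟩, by rw [Nat.sub_add_cancel one_le]⟩
  · rintro ⟨j, rfl⟩
    exact ⟨j + 1, mem_Icc.2 ⟨by lia, by lia⟩, rfl⟩

end Code

/-! ### The weight distribution -/

lemma exists_eq_mul_two_mul_add_one {m d e : ℕ} (he0 : 0 < e) (he : e = m.gcd d)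
    (he' : e = m.gcd (2 * d)) : ∃ h, m = e * (2 * h + 1) := by
  obtain ⟨m', hm'⟩ : e ∣ m := he ▸ Nat.gcd_dvd_left m d
  obtain ⟨d', hd'⟩ : e ∣ d := he ▸ Nat.gcd_dvd_right m d
  have coprime : m'.Coprime (2 * d') := by
    refine Nat.eq_of_mul_eq_mul_left he0 ?_
    rw [← Nat.gcd_mul_left, mul_left_comm, ← hm', ← hd', ← he', mul_one]
  obtain ⟨h, hh⟩ := Nat.coprime_two_right.1 (coprime.coprime_dvd_right (dvd_mul_right 2 d'))
  exact ⟨h, by rw [hm', hh]⟩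

lemma natCard_eq_two_pow_of_finrank_eq {K L : Type*} [Field K] [Field L] [Algebra K L]
    [FiniteDimensional K L] {m e h : ℕ} (hL : Nat.card L = 2 ^ m) (hn : finrank K L = 2 * h + 1)
    (hm : m = e * (2 * h + 1)) : Nat.card K = 2 ^ e := by
  rw [Module.natCard_eq_pow_finrank (K := K), hn, hm, pow_mul] at hL
  exact Nat.pow_left_injective (Nat.succ_ne_zero (2 * h)) hL

section GoldSystem

variable {K L ι : Type*} [Field K] [Field L] [Algebra K L] [Fintype ι]
variable [Algebra (ZMod 2) L] {ρ : ι → L ≃ₐ[K] L} {γ : L} {m e r h i : ℕ} {ε : ℤ}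

lemma goldSum_zero [Fintype L] (ρ : ι → L ≃ₐ[K] L) : goldSum ρ 0 = Fintype.card L := by
  simp [goldSum, walsh, goldForm_zero]

variable [FiniteDimensional K L] [Algebra (ZMod 2) K] [IsScalarTower (ZMod 2) K L]
variable [NeZero (2 ^ m - 1)]

lemma dcFrequency_range_word [Fintype L] (hρ : IsGoldSystem ρ) (hL : Nat.card L = 2 ^ m)
    (hγ : IsPrimitiveRoot γ (2 ^ m - 1)) (hr : m - e * r / 2 < m) (hε : ε ≤ 1) :
    dcFrequency m e (LinearMap.range (word (2 ^ m - 1) ρ γ)) r ε =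
      Nat.card {p // goldSum ρ p = ε * 2 ^ (m - e * r / 2)} := by
  have hL' : Nat.card L = 2 ^ m - 1 + 1 := by rw [hL, Nat.sub_add_cancel Nat.one_le_two_pow]
  have inj := word_injective hρ hL' hγ
  have codewords_eq : {c | c ∈ LinearMap.range (word (2 ^ m - 1) ρ γ) ∧ c ≠ 0 ∧
      DC c = -1 + ε * 2 ^ (m - e * r / 2)} = word (2 ^ m - 1) ρ γ ''
        {p | goldSum ρ p = ε * 2 ^ (m - e * r / 2)} := by
    ext c
    constructor
    · rintro ⟨⟨p, rfl⟩, -, hDC⟩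
      rw [DC_word hL' hγ] at hDC
      exact ⟨p, add_left_cancel hDC, rfl⟩
    · rintro ⟨p, hp : goldSum ρ p = _, rfl⟩
      refine ⟨⟨p, rfl⟩, fun word_eq_zero => ?_, by rw [DC_word hL' hγ, hp]⟩
      rw [(map_eq_zero_iff _ inj).1 word_eq_zero, goldSum_zero, ← Nat.card_eq_fintype_card, hL,
        Nat.cast_pow, Nat.cast_ofNat] at hp
      have : (2 : ℤ) ^ (m - e * r / 2) < 2 ^ m := pow_lt_pow_right₀ one_lt_two hr
      have : (0 : ℤ) < 2 ^ (m - e * r / 2) := by positivity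
      nlinarith
  rw [dcFrequency, codewords_eq, Set.ncard_image_of_injective _ inj]
  rfl

lemma two_mul_dcFrequency_eq_mul_card [Finite L] (hρ : IsGoldSystem ρ) (hL : Nat.card L = 2 ^ m)
    (hγ : IsPrimitiveRoot γ (2 ^ m - 1)) (hn : finrank K L = 2 * h + 1) (he0 : 0 < e)
    (hm : m = e * (2 * h + 1)) (hi : i < h) (hε : ε = 1 ∨ ε = -1) :
    2 * (dcFrequency m e (LinearMap.range (word (2 ^ m - 1) ρ γ)) (2 * h - 2 * i) ε : ℤ) =
      (2 ^ (e * (h - i) * 2) + ε * 2 ^ (e * (h - i))) *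
        Nat.card {a : ι → L // finrank K (LinearMap.ker (polarOp ρ a)) = 2 * i + 1} := by
  have := Fintype.ofFinite L
  have exponent : m - e * (2 * h - 2 * i) / 2 = e * (h + 1 + i) := by
    rw [← Nat.mul_sub, mul_left_comm, Nat.mul_div_cancel_left _ two_pos, hm, ← Nat.mul_sub]
    congr 1
    lia
  have exponent_lt : e * (h + 1 + i) < m := hm ▸ Nat.mul_lt_mul_of_pos_left (by lia) he0
  rw [dcFrequency_range_word hρ hL hγ (by rwa [exponent]) (by lia), exponent]
  have sums := two_mul_card_goldSum hn hi.le (by rcases hε with rfl | rfl <;> rfl) ρ (ε := ε)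
  rwa [natCard_eq_two_pow_of_finrank_eq hL hn hm, Nat.cast_pow, Nat.cast_ofNat, ← pow_mul 2 e,
    ← pow_mul 2 e, ← pow_mul] at sums

theorem two_mul_dcFrequency_range_word [Finite L] (hρ : IsGoldSystem ρ) (hL : Nat.card L = 2 ^ m)
    (hγ : IsPrimitiveRoot γ (2 ^ m - 1)) (hn : finrank K L = 2 * h + 1) (he0 : 0 < e)
    (hm : m = e * (2 * h + 1)) (hi : i < Fintype.card ι) (hε : ε = 1 ∨ ε = -1) :
    2 * (dcFrequency m e (LinearMap.range (word (2 ^ m - 1) ρ γ)) (2 * h - 2 * i) ε : ℚ) =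
      (2 ^ (e * (h - i) * 2) + ε * 2 ^ (e * (h - i))) *
        ∑ j ∈ Icc i (Fintype.card ι - 1), (-1) ^ (j - i) * 4 ^ (e * (j - i).choose 2) *
          gaussBinom (4 ^ e) j i * gaussBinom (4 ^ e) h j *
            (2 ^ (m * (Fintype.card ι - j)) - 1) := by
  have := Finite.of_injective _ (algebraMap K L).injective
  have two_mul_card_lt := hρ.two_mul_card_lt
  have frequency := two_mul_dcFrequency_eq_mul_card hρ hL hγ hn he0 hm (i := i) (by lia) hε
  have card_sq : ((2 ^ e : ℕ) : ℚ) ^ 2 = 4 ^ e := by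
    rw [Nat.cast_pow, ← pow_mul, mul_comm, pow_mul]
    norm_num
  have radicals := hρ.card_finrank_ker_eq hn hi
  simp only [natCard_eq_two_pow_of_finrank_eq hL hn hm, card_sq, hn] at radicals
  calc 2 * (dcFrequency m e (LinearMap.range (word (2 ^ m - 1) ρ γ)) (2 * h - 2 * i) ε : ℚ)
      = (2 ^ (e * (h - i) * 2) + ε * 2 ^ (e * (h - i))) *
          Nat.card {a : ι → L // finrank K (LinearMap.ker (polarOp ρ a)) = 2 * i + 1} := by
        exact_mod_cast frequency
    _ = _ := by
        rw [radicals]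
        congr 1
        refine sum_congr rfl fun j _ => ?_
        rw [Nat.cast_pow, Nat.cast_ofNat, ← pow_mul, ← pow_mul, ← mul_assoc e, ← hm]
        ring

end GoldSystem

theorem two_mul_dcFrequency_code {m d e k h i : ℕ} {ε : ℤ} {s : BinSeq (2 ^ m - 1)} (F : Family)
    (hs : IsMaximumLength m s) (he0 : 0 < e) (he : e = m.gcd d) (he' : e = m.gcd (2 * d))
    (hm : m = e * (2 * h + 1)) (hk : k - 1 ≤ h) (hi : i < k - 1) (hε : ε = 1 ∨ ε = -1) :
    2 * (dcFrequency m e (code F m d e k s) (2 * h - 2 * i) ε : ℚ) =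
      (2 ^ (e * (h - i) * 2) + ε * 2 ^ (e * (h - i))) *
        ∑ j ∈ Icc i (k - 1 - 1), (-1) ^ (j - i) * 4 ^ (e * (j - i).choose 2) *
          gaussBinom (4 ^ e) j i * gaussBinom (4 ^ e) h j * (2 ^ (m * (k - 1 - j)) - 1) := by
  have hm0 : 0 < m := hm ▸ Nat.mul_pos he0 (Nat.succ_pos _)
  obtain ⟨L, _, _, _, γ, b, hL, hγ, hb, hsγ⟩ := hs.exists_field hm0
  have degree : finrank (ZMod 2) L = m := by
    rw [Module.natCard_eq_pow_finrank (K := ZMod 2), Nat.card_zmod] at hL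
    exact Nat.pow_right_injective le_rfl hL
  obtain ⟨K, ρ, hρ, hn, hfac⟩ := F.exists_isGoldSystem degree he0 he he' hm hk
  have hodd (j) : Odd (orderOf (ρ j)) := by
    refine Odd.of_dvd_nat (n := finrank K L) (hn ▸ odd_two_mul_add_one h) ?_
    rw [← IsGalois.card_aut_eq_finrank]
    exact orderOf_dvd_natCard _
  have hfactor (j : Fin (k - 1)) (x : L) : x * ρ j x = x ^ F.factor m d e (j + 1) := by
    rw [hfac, Family.factor, pow_succ']
  have : NeZero (2 ^ m - 1) := ⟨(Nat.sub_pos_of_lt (Nat.one_lt_two_pow hm0.ne')).ne'⟩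
  have hL' : Nat.card L = 2 ^ m - 1 + 1 := by rw [hL, Nat.sub_add_cancel Nat.one_le_two_pow]
  rw [code_eq_span_fin, span_shift_eq_range_word hL' hγ hb hsγ hodd hfactor]
  simpa only [Fintype.card_fin] using
    two_mul_dcFrequency_range_word hρ hL hγ hn he0 hm (by rwa [Fintype.card_fin]) hε

end GoldType

theorem theorem1p2 (m d e k : ℕ) (hm : 0 < m) (hd : 0 < d)
    (he : e = Nat.gcd m d) (he' : e = Nat.gcd m (2 * d))
    (hk : 2 ≤ k) (hk' : k ≤ (m + e) / (2 * e))
    (s : GoldType.BinSeq (2 ^ m - 1)) (hs : GoldType.IsMaximumLength m s)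
    (F : GoldType.Family) (i : ℕ) (hi : i ≤ k - 2) (ε : ℤ) (hε : ε = 1 ∨ ε = -1) :
    (GoldType.dcFrequency m e (GoldType.code F m d e k s) ((m - e) / e - 2 * i) ε : ℚ) =
      1 / 2 * (2 ^ (m - e - 2 * e * i) + (ε : ℚ) * 2 ^ ((m - e) / 2 - e * i)) *
        ∑ j ∈ Finset.Icc i (k - 2),
          (-1) ^ (j - i) * 4 ^ (e * Nat.choose (j - i) 2) *
            GoldType.gaussBinom (4 ^ e) j i *
            GoldType.gaussBinom (4 ^ e) ((m - e) / (2 * e)) j *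
            (2 ^ (m * (k - 1 - j)) - 1) := by
  have he0 : 0 < e := he ▸ Nat.gcd_pos_of_pos_left d hm
  obtain ⟨h, hmh⟩ := GoldType.exists_eq_mul_two_mul_add_one he0 he he'
  have m_sub : m - e = e * (2 * h) := by rw [hmh, mul_add_one, Nat.add_sub_cancel]
  have div_e : (m - e) / e = 2 * h := by rw [m_sub, Nat.mul_div_cancel_left _ he0]
  have div_two : (m - e) / 2 = e * h := by
    rw [m_sub, mul_left_comm, Nat.mul_div_cancel_left _ two_pos]
  have div_two_e : (m - e) / (2 * e) = h := by
    rw [← Nat.div_div_eq_div_mul, div_two, Nat.mul_div_cancel_left _ he0]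
  have exponent : m - e - 2 * e * i = e * (h - i) * 2 := by
    rw [m_sub, mul_left_comm, mul_assoc, ← Nat.mul_sub, ← Nat.mul_sub, mul_comm]
  have add_div : (m + e) / (2 * e) = h + 1 :=
    Nat.div_eq_of_eq_mul_left (by lia) (by rw [hmh]; ring)
  have frequency := GoldType.two_mul_dcFrequency_code (i := i) F hs he0 he he' hmh
    (k := k) (by lia) (by lia) hε
  rw [div_e, div_two, div_two_e, exponent, ← Nat.mul_sub e, show k - 2 = k - 1 - 1 by lia]
  linear_combination (1 / 2 : ℚ) * frequency
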